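/- Let $k=\mathbb{F}_q$ be a finite field of characteristic $p$, let $m\ge 2$ be an integer with $\gcd(p,m)=1$, and let $r\ge 1$ and $\lambda$ be integers with $\gcd(m,r\lambda)=1$. Let $\alpha_1,\dots,\alpha_r\in k$ be pairwise distinct, and let $F=k(x,y)$ be the Kummer extension of the rational function field $k(x)$ given by $$y^m=\prod_{\mu=1}^r (x-\alpha_\mu)^{\lambda}.$$ For $1\le\mu\le r$ let $P_\mu$ be the (unique, totally ramified) place of $F$ over the zero of $x-\alpha_\mu$, and let $P_\infty$ be the (unique, totally ramified) place of $F$ over the pole of $x$. For a divisor $D$ of $F$ let $\mathcal{L}(D)=\{f\in F\setminus\{0\}: (f)+D\ge 0\}\cup\{0\}$ and $\ell(D)=\dim_k\mathcal{L}(D)$. If $\ell(D)>0$, the floor $\lfloor D\rfloor$ is the unique divisor $D'$ of minimum degree with $\mathcal{L}(D')=\mathcal{L}(D)$. For integers $s_1,\dots,s_r,t$ let $\Omega_{s_1,\dots,s_r,t}$ be the set of all $(i,j_2,\dots,j_r)\in\mathbb{Z}^r$ such that $$i+s_1\ge 0,\qquad 0\le i+mj_\mu+s_\mu<m\ \ (2\le\mu\le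 r),\qquad ri+m(j_2+\cdots+j_r)\le t.$$ **Theorem.** Let $H=s_1P_1+\cdots+s_rP_r+tP_\infty$ with $\ell(H)>0$. Then $$\lfloor H\rfloor=s_1'P_1+\cdots+s_r'P_r+t'P_\infty,$$ where $$s_1'=\max\{-i\},\qquad s_\mu'=\max\{-i-mj_\mu\}\ \ (2\le\mu\le r),\qquad t'=\max\Big\{ri+m\sum_{\mu=2}^r j_\mu\Big\},$$ each maximum being taken over all $(i,j_2,\dots,j_r)\in\Omega_{s_1,\dots,s_r,t}$; in particular these maxima exist. -/

import Mathlib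

namespace FunField

/-- A place of the field extension `F / k`, given by its normalized discrete valuation
`v : F → ℤ ∪ {∞}`: a surjective additive valuation that is trivial on the constants `k`. -/
structure Place (k F : Type*) [Field k] [Field F] [Algebra k F] where
  /-- The normalized discrete valuation of the place. -/
  v : AddValuation F (WithTop ℤ)
  exists_eq : ∀ n : ℤ, ∃ f : F, v f = (n : WithTop ℤ)
  map_const : ∀ c : k, c ≠ 0 → v (algebraMap k F c) = 0

section

variable {k F : Type*} [Field k] [Field F] [Algebra k F]

theorem Place.const_nonneg (P : Place k F) (c : k) : 0 ≤ P.v (algebraMap k F c) := by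
  by_cases hc : c = 0
  · subst hc
    rw [map_zero, AddValuation.map_zero]
    exact le_top
  · exact (P.map_const c hc).ge

/-- The valuation ring `{f | 0 ≤ v f}` of a place, as a `k`-algebra. -/
def Place.valuationRing (P : Place k F) : Subalgebra k F where
  carrier := {f | 0 ≤ P.v f}
  mul_mem' := fun {a b} ha hb => by
    change 0 ≤ P.v (a * b)
    rw [AddValuation.map_mul]
    exact add_nonneg ha hb
  add_mem' := fun {a b} ha hb => AddValuation.map_le_add P.v ha hb
  algebraMap_mem' := fun c => P.const_nonneg c

/-- The maximal ideal `{f | 0 < v f}` of the valuation ring of a place. -/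
def Place.maxIdeal (P : Place k F) : Ideal P.valuationRing where
  carrier := {f | 0 < P.v (f : F)}
  zero_mem' := by
    change 0 < P.v (0 : F)
    rw [AddValuation.map_zero]
    exact WithTop.coe_lt_top 0
  add_mem' := fun {a b} ha hb => AddValuation.map_lt_add P.v ha hb
  smul_mem' := fun c f hf => by
    change 0 < P.v ((c : F) * (f : F))
    rw [AddValuation.map_mul]
    exact lt_of_lt_of_le hf (le_add_of_nonneg_left c.2)

/-- The degree of a place: the dimension over `k` of its residue field. -/
noncomputable def Place.degree (P : Place k F) : ℕ :=
  Module.finrank k (P.valuationRing ⧸ P.maxIdeal)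

/-- The divisors of `F / k`: the free abelian group on the places. -/
abbrev Divisor (k F : Type*) [Field k] [Field F] [Algebra k F] : Type _ :=
  Place k F →₀ ℤ

/-- The degree of a divisor, `∑ n_P deg P`. -/
noncomputable def Divisor.degree (D : Divisor k F) : ℤ :=
  D.sum fun P n => n * (P.degree : ℤ)

/-- The Riemann-Roch space `L(D) = {f ≠ 0 | (f) + D ≥ 0} ∪ {0}`, where `(f) + D ≥ 0` says that
`v_P(f) ≥ - D(P)` for every place `P` (for `f = 0` this holds as `v_P(0) = ∞`). -/
def riemannRochSpace (D : Divisor k F) : Submodule k F where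
  carrier := {f | ∀ P : Place k F, ((-(D P) : ℤ) : WithTop ℤ) ≤ P.v f}
  zero_mem' := fun P => by
    rw [AddValuation.map_zero]
    exact le_top
  add_mem' := fun {a b} ha hb P => AddValuation.map_le_add P.v (ha P) (hb P)
  smul_mem' := fun c f hf P => by
    rw [Algebra.smul_def, AddValuation.map_mul]
    exact le_trans (hf P) (le_add_of_nonneg_left (P.const_nonneg c))

/-- `ℓ(D)`, the dimension over `k` of the Riemann-Roch space of `D`. -/
noncomputable def ell (D : Divisor k F) : ℕ :=
  Module.finrank k (riemannRochSpace D)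

/-- `D` has the least degree among all divisors with the same Riemann-Roch space as `G`. -/
def HasMinDegree (G D : Divisor k F) : Prop :=
  riemannRochSpace G = riemannRochSpace D ∧
    ∀ D' : Divisor k F, riemannRochSpace G = riemannRochSpace D' → D.degree ≤ D'.degree

/-- `D` is the floor `⌊G⌋` of `G`: the unique divisor of minimum degree whose Riemann-Roch space
is that of `G`. -/
def IsFloor (G D : Divisor k F) : Prop :=
  HasMinDegree G D ∧ ∀ D' : Divisor k F, HasMinDegree G D' → D' = D

/-- The divisor `∑ s_μ P_μ + t P_∞`. -/
noncomputable def kummerDivisor {r : ℕ} (P : Fin r → Place k F) (Pinf : Place k F)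
    (s : Fin r → ℤ) (t : ℤ) : Divisor k F :=
  (∑ μ, Finsupp.single (P μ) (s μ)) + Finsupp.single Pinf t

end

/-- The set `Ω_{s_1, …, s_r, t}` of lattice points `(i, j_2, …, j_r)`, with `r = n + 1`. The index
`0 : Fin (n + 1)` stands for the first place, and `a.succ`, for `a : Fin n`, for the others; the
coordinate `j` with index `a : Fin n` belongs to the place with index `a.succ`. -/
def latticeOmega (m : ℕ) {n : ℕ} (s : Fin (n + 1) → ℤ) (t : ℤ) : Set (ℤ × (Fin n → ℤ)) :=
  {w | 0 ≤ w.1 + s 0 ∧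
    (∀ a : Fin n, 0 ≤ w.1 + m * w.2 a + s a.succ ∧ w.1 + m * w.2 a + s a.succ < m) ∧
    ((n + 1 : ℕ) : ℤ) * w.1 + m * ∑ a, w.2 a ≤ t}

end FunField

/-! By Bezout `y` may be replaced by `z` with `z ^ m = h(x)`, `h = ∏ (x - α μ)`, and `y = z ^ l`.
Integral elements over `k[x]` have coordinates in `1, z, …, z ^ (m - 1)` whose denominators are
powers of `h`, because the discriminant of this basis is a constant times `h ^ (m - 1)`. The places
over the `α μ` and over infinity are totally ramified: `z` has order `1`, respectively `-(n + 1)`,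
there, and nonzero polynomials in `x` have orders divisible by `m`. Hence the nonzero terms of `∑
p_i(x) z ^ i` have distinct orders, and the order of the sum is the minimum
(`Place.map_sum_aeval_mul_pow`).

For `f` in `L(H)` this shows that each nonzero term of its expansion obeys the order bounds of `H`
at the special places. Its orders `V μ` there and its pole order `T` at infinity satisfy congruences
modulo `m`, and `∑ V μ ≤ T`, since a polynomial has no more roots than its degree. These conditions
suffice to produce points of `Ω` with orders at most `V μ`, and one with pole order exactly `T`
(`exists_lattice_points`). So no function in `L(H)` exceeds the pole orders given by the maxima over
`Ω` (`IsKummer.exists_lattice_le`).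

Conversely, a point of `Ω` gives the function `z ^ i ∏ (x - α_a) ^ j_a`, which lies in `L(H)`,
attains the orders of that point, and is a unit at all other places. Every coefficient of the
proposed divisor is therefore attained, so any divisor with the same Riemann-Roch space dominates it
(`isFloor_kummerDivisor`). Uniqueness in minimal degree then needs only that all places have
positive degree (`Place.degree_pos_of_adjoin_pair`). -/

open Polynomial

namespace FunField

/-! ### Places from primes of Dedekind domains, and integrality tested at places. -/

section Dedekind

variable {k F : Type*} [Field k] [Field F] [Algebra k F]

/-- The additive valuation `f ↦ -log (w f)` of a valuation `w` with values in `ℤᵐ⁰`. -/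
noncomputable def logValuation (w : Valuation F (WithZero (Multiplicative ℤ))) :
    AddValuation F (WithTop ℤ) :=
  open Classical in
  AddValuation.of (fun f => if f = 0 then ⊤ else ((-(WithZero.log (w f)) : ℤ) : WithTop ℤ))
    (by simp) (by simp)
    (fun f g => by
      by_cases hf : f = 0
      · rw [hf, zero_add]; exact min_le_right _ _
      by_cases hg : g = 0
      · rw [hg, add_zero]; exact min_le_left _ _
      by_cases hfg : f + g = 0
      · simp [hfg]
      simp only [hf, hg, hfg, if_false, min_le_iff, WithTop.coe_le_coe, neg_le_neg_iff]
      have hf' : w f ≠ 0 := by simpa using hf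
      have hg' : w g ≠ 0 := by simpa using hg
      have hfg' : w (f + g) ≠ 0 := by simpa using hfg
      rw [WithZero.log_le_log hfg' hf', WithZero.log_le_log hfg' hg', ← le_max_iff]
      exact w.map_add f g)
    (fun f g => by
      by_cases hf : f = 0
      · simp [hf]
      by_cases hg : g = 0
      · simp [hg]
      have hf' : w f ≠ 0 := by simpa using hf
      have hg' : w g ≠ 0 := by simpa using hg
      simp only [hf, hg, mul_eq_zero, or_self, if_false, map_mul, WithZero.log_mul hf' hg']
      rw [← WithTop.coe_add, neg_add])

theorem logValuation_apply (w : Valuation F (WithZero (Multiplicative ℤ))) {f : F} (hf : f ≠ 0) :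
    logValuation w f = ((-(WithZero.log (w f)) : ℤ) : WithTop ℤ) := by
  classical
  simp [logValuation, AddValuation.of_apply, hf]

theorem logValuation_nonneg_iff (w : Valuation F (WithZero (Multiplicative ℤ))) (f : F) :
    0 ≤ logValuation w f ↔ w f ≤ 1 := by
  by_cases hf : f = 0
  · simp [hf]
  have hf' : w f ≠ 0 := by simpa using hf
  rw [logValuation_apply w hf, ← WithTop.coe_zero, WithTop.coe_le_coe, Left.nonneg_neg_iff,
    ← WithZero.log_one, WithZero.log_le_log hf' one_ne_zero]

/-- The place of a nonzero prime of a Dedekind domain with fraction field `F`. -/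
noncomputable def Place.ofPrime {B : Type*} [CommRing B] [IsDedekindDomain B] [Algebra B F]
    [IsFractionRing B F] [Algebra k B] [IsScalarTower k B F]
    (w : IsDedekindDomain.HeightOneSpectrum B) : Place k F where
  v := logValuation (w.valuation F)
  exists_eq n := by
    obtain ⟨f, hf⟩ := w.valuation_surjective F (WithZero.exp (-n))
    have hf0 : f ≠ 0 := by
      rintro rfl
      rw [map_zero] at hf
      exact WithZero.exp_ne_zero hf.symm
    exact ⟨f, by rw [logValuation_apply _ hf0, hf, WithZero.log_exp, neg_neg]⟩
  map_const c hc := by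
    have hcF : algebraMap k F c ≠ 0 := by simpa using hc
    have key : ∀ d : k, 0 ≤ logValuation (w.valuation F) (algebraMap k F d) := fun d => by
      rw [logValuation_nonneg_iff, IsScalarTower.algebraMap_apply k B F]
      exact w.valuation_le_one _
    have h := key c⁻¹
    have h1 : logValuation (w.valuation F) (algebraMap k F c) +
        logValuation (w.valuation F) (algebraMap k F c⁻¹) = 0 := by
      rw [← AddValuation.map_mul, ← map_mul, mul_inv_cancel₀ hc, map_one, AddValuation.map_one]
    refine le_antisymm ?_ (key c)
    calc _ ≤ _ := le_add_of_nonneg_right h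
      _ = 0 := h1

/-- The integral closure of `k[X]` in `F` is a Dedekind domain with fraction field `F`, hence the
intersection of its valuation rings. Each of its primes gives a place at which `X` is integral. -/
theorem isIntegral_of_forall_place (K : Type*) [Field K] [Algebra k[X] K] [IsFractionRing k[X] K]
    [Algebra k[X] F] [Algebra K F] [IsScalarTower k[X] K F] [IsScalarTower k k[X] F]
    [FiniteDimensional K F] [Algebra.IsSeparable K F] {f : F}
    (hf : ∀ Q : Place k F, 0 ≤ Q.v (algebraMap k[X] F X) → 0 ≤ Q.v f) : IsIntegral k[X] f := by
  have : IsDedekindDomain (integralClosure k[X] F) :=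
    integralClosure.isDedekindDomain k[X] K F
  have : IsFractionRing (integralClosure k[X] F) F :=
    integralClosure.isFractionRing_of_finite_extension K F
  have : IsScalarTower k (integralClosure k[X] F) F := by
    refine IsScalarTower.of_algebraMap_eq fun c => ?_
    rw [IsScalarTower.algebraMap_apply k k[X] F,
      IsScalarTower.algebraMap_apply k k[X] (integralClosure k[X] F)]
    rfl
  obtain ⟨b, rfl⟩ := IsDedekindDomain.HeightOneSpectrum.mem_integers_of_valuation_le_one
    (R := integralClosure k[X] F) F f fun w => by
      rw [← logValuation_nonneg_iff]
      refine hf (Place.ofPrime w) ?_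
      change 0 ≤ logValuation (w.valuation F) _
      rw [logValuation_nonneg_iff,
        IsScalarTower.algebraMap_apply k[X] (integralClosure k[X] F) F]
      exact w.valuation_le_one _
  exact b.2

end Dedekind

/-! ### The radical extension `z ^ m = h`: irreducibility, separability, discriminant. -/

section Radical

variable {k F : Type*} [Field k] [Field F]

/-- Eisenstein's criterion at the prime `X - a`, which divides `h` exactly once. -/
theorem irreducible_X_pow_sub_C_of_simple_root {m : ℕ} (hm : m ≠ 0) {h g : k[X]} {a : k}
    (hh : h = (X - C a) * g) (hg : g.eval a ≠ 0) : Irreducible (X ^ m - C h : k[X][X]) := by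
  have hp : Prime (X - C a) := prime_X_sub_C a
  have hmon : (X ^ m - C h : k[X][X]).Monic := monic_X_pow_sub_C h hm
  refine irreducible_of_eisenstein_criterion (P := Ideal.span {X - C a})
    ((Ideal.span_singleton_prime hp.ne_zero).2 hp) ?_ ?_ ?_ ?_ hmon.isPrimitive
  · rw [hmon.leadingCoeff, Ideal.mem_span_singleton]
    exact fun h1 => hp.not_isUnit (isUnit_of_dvd_one h1)
  · intro n hn
    rw [degree_X_pow_sub_C (Nat.pos_of_ne_zero hm), Nat.cast_lt] at hn
    rw [Ideal.mem_span_singleton, coeff_sub, coeff_X_pow, if_neg hn.ne, zero_sub, dvd_neg, coeff_C]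
    split_ifs
    · exact hh ▸ dvd_mul_right _ _
    · exact dvd_zero _
  · rw [degree_X_pow_sub_C (Nat.pos_of_ne_zero hm)]
    exact_mod_cast Nat.pos_of_ne_zero hm
  · rw [Ideal.span_singleton_pow, Ideal.mem_span_singleton, coeff_sub, coeff_X_pow,
      if_neg (Ne.symm hm), zero_sub, dvd_neg, coeff_C_zero, hh, pow_two,
      mul_dvd_mul_iff_left hp.ne_zero, dvd_iff_isRoot]
    exact hg

variable [Algebra k[X] F]

theorem isIntegral_of_pow_eq {m : ℕ} (hm : m ≠ 0) {h : k[X]} {z : F}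
    (hz : z ^ m = algebraMap k[X] F h) : IsIntegral k[X] z :=
  ⟨X ^ m - C h, monic_X_pow_sub_C h hm, by simp [hz]⟩

variable (K : Type*) [Field K] [Algebra k[X] K] [Algebra K F] [IsScalarTower k[X] K F]

theorem finiteDimensional_of_pow_eq {m : ℕ} (hm : m ≠ 0) {h : k[X]} {z : F}
    (hz : z ^ m = algebraMap k[X] F h)
    (htop : IntermediateField.adjoin K {z} = ⊤) :
    FiniteDimensional K F := by
  have : FiniteDimensional K
      (IntermediateField.adjoin K {z}) :=
    IntermediateField.adjoin.finiteDimensional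
      ((isIntegral_of_pow_eq hm hz).tower_top)
  rw [htop] at this
  exact Module.Finite.equiv (IntermediateField.topEquiv (F := K) (E := F)).toLinearEquiv

variable [IsFractionRing k[X] K]

theorem minpoly_of_pow_eq {m : ℕ} (hm : m ≠ 0) {h g : k[X]} {a : k} (hh : h = (X - C a) * g)
    (hg : g.eval a ≠ 0) {z : F} (hz : z ^ m = algebraMap k[X] F h) :
    minpoly K z = X ^ m - C (algebraMap k[X] K h) := by
  have hmon : (X ^ m - C h : k[X][X]).Monic := monic_X_pow_sub_C h hm
  have hirr := (hmon.irreducible_iff_irreducible_map_fraction_map (K := K)).1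
    (irreducible_X_pow_sub_C_of_simple_root hm hh hg)
  rw [Polynomial.map_sub, Polynomial.map_pow, map_X, map_C] at hirr
  refine (minpoly.eq_of_irreducible_of_monic hirr ?_ (monic_X_pow_sub_C _ hm)).symm
  rw [map_sub, map_pow, aeval_X, aeval_C, hz, ← IsScalarTower.algebraMap_apply, sub_self]

theorem isSeparable_of_pow_eq {m : ℕ} (hm : (m : k) ≠ 0) {h g : k[X]} {a : k}
    (hh : h = (X - C a) * g) (hg : g.eval a ≠ 0) {z : F} (hz : z ^ m = algebraMap k[X] F h)
    (htop : IntermediateField.adjoin K {z} = ⊤) :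
    Algebra.IsSeparable K F := by
  have hm0 : m ≠ 0 := by rintro rfl; simp at hm
  have hmK : (m : K) ≠ 0 := by
    rw [← map_natCast (algebraMap k[X] K), ← map_natCast (C : k →+* k[X])]
    exact (map_ne_zero_iff _ (IsFractionRing.injective k[X] K)).2 (C_ne_zero.2 hm)
  have hh0 : h ≠ 0 := by
    rw [hh]
    refine mul_ne_zero (X_sub_C_ne_zero a) ?_
    rintro rfl
    simp at hg
  have hs : IsSeparable K z := by
    rw [IsSeparable, minpoly_of_pow_eq K hm0 hh hg hz]
    exact separable_X_pow_sub_C _ hmK (by simpa using hh0)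
  have := (IntermediateField.isSeparable_adjoin_simple_iff_isSeparable K F).2 hs
  rw [htop] at this
  exact (AlgEquiv.Algebra.isSeparable_iff
    (IntermediateField.topEquiv (F := K) (E := F))).1 this

/-- A power of `h` is a common denominator for the coordinates of the integral elements. -/
theorem exists_pow_mul_eq_sum {m : ℕ} (hm : (m : k) ≠ 0) {h g : k[X]} {a : k}
    (hh : h = (X - C a) * g) (hg : g.eval a ≠ 0) {z : F} (hz : z ^ m = algebraMap k[X] F h)
    (htop : IntermediateField.adjoin K {z} = ⊤)
    {f : F} (hf : IsIntegral k[X] f) :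
    ∃ (N : ℕ) (p : Fin m → k[X]),
      algebraMap k[X] F (h ^ N) * f = ∑ i, algebraMap k[X] F (p i) * z ^ (i : ℕ) := by
  have hm0 : m ≠ 0 := by rintro rfl; simp at hm
  have := finiteDimensional_of_pow_eq K hm0 hz htop
  have := isSeparable_of_pow_eq K hm hh hg hz htop
  have hzint := isIntegral_of_pow_eq hm0 hz
  have hzK : IsIntegral K z := hzint.tower_top
  have hmin := minpoly_of_pow_eq K hm0 hh hg hz
  have hadj : Algebra.adjoin K {z} = ⊤ := by
    rw [← IntermediateField.adjoin_simple_toSubalgebra_of_isAlgebraic hzK.isAlgebraic, htop,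
      IntermediateField.top_toSubalgebra]
  let B := PowerBasis.ofAdjoinEqTop hzK hadj
  have hgen : B.gen = z := rfl
  -- The constant coefficient of the minimal polynomial `X ^ m - h` is `-h`, so the norm of `z` is
  -- `h` up to sign.
  have hnorm : ∃ ε : k, ε ≠ 0 ∧ Algebra.norm K z =
      algebraMap k[X] K (C ε * h) := by
    refine ⟨(-1) ^ B.dim * -1, by simp, ?_⟩
    rw [← hgen, Algebra.PowerBasis.norm_gen_eq_coeff_zero_minpoly, hgen, hmin, coeff_sub,
      coeff_X_pow, if_neg (Ne.symm hm0), coeff_C_zero]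
    simp
  -- Up to sign the discriminant is the norm of the derivative `m z ^ (m - 1)` of the minimal
  -- polynomial at `z`. As `m` is invertible in `k`, only the power of `h` matters.
  have hdisc : ∃ ε : k, ε ≠ 0 ∧ Algebra.discr K B.basis =
      algebraMap k[X] K (C ε * h ^ (m - 1)) := by
    obtain ⟨ε, hε, hN⟩ := hnorm
    refine ⟨(-1) ^ (Module.finrank K F *
      (Module.finrank K F - 1) / 2) *
      ((m : k) ^ Module.finrank K F * ε ^ (m - 1)), by simp [hm, hε], ?_⟩
    have hd : aeval z (derivative (minpoly K z)) =
        algebraMap K F (m : K) * z ^ (m - 1) := by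
      rw [hmin]
      simp [derivative_X_pow]
    rw [Algebra.discr_powerBasis_eq_norm, hgen, hd, map_mul, map_pow, Algebra.norm_algebraMap, hN]
    simp only [map_mul, map_pow, map_neg, map_one, map_natCast]
    ring
  obtain ⟨ε, hε, hD⟩ := hdisc
  have hmem := Algebra.discr_mul_isIntegral_mem_adjoin (R := k[X]) K
    (B := B) (by rwa [hgen]) hf
  rw [hgen, hD, Algebra.adjoin_singleton_eq_range_aeval] at hmem
  obtain ⟨P, hP⟩ := hmem
  -- Reduction modulo the monic polynomial `X ^ m - h`, which vanishes at `z`, leaves only exponents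
  -- below `m`.
  have hmon : (X ^ m - C h : k[X][X]).Monic := monic_X_pow_sub_C h hm0
  have hdeg : (P %ₘ (X ^ m - C h)).natDegree < m := by
    have := natDegree_modByMonic_lt P hmon (by
      intro h1
      have := congrArg natDegree h1
      rw [natDegree_X_pow_sub_C, natDegree_one] at this
      exact hm0 this)
    rwa [natDegree_X_pow_sub_C] at this
  have hP' : aeval z (P %ₘ (X ^ m - C h)) = aeval z P :=
    aeval_modByMonic_eq_self_of_root (by simp [hz])
  refine ⟨m - 1, fun i => C ε⁻¹ * (P %ₘ (X ^ m - C h)).coeff i, ?_⟩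
  have hsum := aeval_eq_sum_range' hdeg z
  rw [hP', Finset.sum_range] at hsum
  have hP2 : algebraMap k[X] F (C ε * h ^ (m - 1)) * f = aeval z P := by
    rw [IsScalarTower.algebraMap_apply k[X] K F, ← Algebra.smul_def]
    exact hP.symm
  calc algebraMap k[X] F (h ^ (m - 1)) * f
      = algebraMap k[X] F (C ε⁻¹) * (algebraMap k[X] F (C ε * h ^ (m - 1)) * f) := by
        rw [← mul_assoc, ← map_mul, ← mul_assoc, ← C_mul, inv_mul_cancel₀ hε, C_1, one_mul]
    _ = _ := by
        rw [hP2, hsum, Finset.mul_sum]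
        refine Finset.sum_congr rfl fun i _ => ?_
        rw [Algebra.smul_def, map_mul, mul_assoc]

end Radical

/-! ### Values of polynomials in `x` at a place. -/

section ValuationPolynomial

variable {k F : Type*} [Field k] [Field F] [Algebra k F]

theorem Place.exists_int (P : Place k F) {f : F} (hf : f ≠ 0) : ∃ n : ℤ, P.v f = n :=
  (WithTop.ne_top_iff_exists.1 ((AddValuation.ne_top_iff _).2 hf)).imp fun _ h => h.symm

theorem Place.aeval_nonneg (P : Place k F) {x : F} (hx : 0 ≤ P.v x) (p : k[X]) :
    0 ≤ P.v (aeval x p) := by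
  have h : aeval x p ∈ P.valuationRing :=
    Algebra.adjoin_le (S := P.valuationRing) (Set.singleton_subset_iff.2 hx)
      (aeval_mem_adjoin_singleton k x)
  exact h

theorem Place.nonneg_of_sub_const (P : Place k F) {x : F} {a : k}
    (hx : 0 ≤ P.v (x - algebraMap k F a)) : 0 ≤ P.v x := by
  have := AddValuation.map_le_add P.v hx (P.const_nonneg a)
  rwa [sub_add_cancel] at this

/-- In `q(x) = q(a) + (x - a) r(x)` the first term is a nonzero constant and the second has positive
value. -/
theorem Place.aeval_eq_zero_of_eval_ne_zero (P : Place k F) {x : F} {a : k}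
    (hx : 0 < P.v (x - algebraMap k F a)) {q : k[X]} (hq : q.eval a ≠ 0) :
    P.v (aeval x q) = 0 := by
  have hdiv : aeval x q = algebraMap k F (q.eval a) +
      (x - algebraMap k F a) * aeval x (q /ₘ (X - C a)) := by
    conv_lhs => rw [← modByMonic_add_div q (X - C a)]
    rw [modByMonic_X_sub_C_eq_C_eval]
    simp
  have h1 := P.map_const _ hq
  rw [hdiv, AddValuation.map_add_eq_of_lt_left, h1]
  rw [h1, AddValuation.map_mul]
  exact lt_of_lt_of_le hx
    (le_add_of_nonneg_right (P.aeval_nonneg (P.nonneg_of_sub_const hx.le) _))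

theorem Place.aeval_eq_rootMultiplicity (P : Place k F) {x : F} {a : k}
    (hx : 0 < P.v (x - algebraMap k F a)) {p : k[X]} (hp : p ≠ 0) :
    P.v (aeval x p) = p.rootMultiplicity a • P.v (x - algebraMap k F a) := by
  obtain ⟨q, hq, hq'⟩ := exists_eq_pow_rootMultiplicity_mul_and_not_dvd p hp a
  rw [dvd_iff_isRoot] at hq'
  conv_lhs => rw [hq]
  rw [map_mul, AddValuation.map_mul, P.aeval_eq_zero_of_eval_ne_zero hx hq', add_zero, map_pow,
    AddValuation.map_pow]
  simp

/-- Factor out `x ^ deg p`. What remains is the reversed polynomial in `1 / x`, a unit, because `1 /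
x` vanishes at the place and the constant coefficient is the leading coefficient of `p`. -/
theorem Place.aeval_eq_natDegree (P : Place k F) {x : F} (hx : P.v x < 0) {p : k[X]}
    (hp : p ≠ 0) : P.v (aeval x p) = p.natDegree • P.v x := by
  have hx0 : x ≠ 0 := by
    rintro rfl
    simp at hx
  obtain ⟨n, hn⟩ := P.exists_int hx0
  have hinv : 0 < P.v (x⁻¹ - algebraMap k F 0) := by
    have h1 : P.v x + P.v x⁻¹ = 0 := by
      rw [← AddValuation.map_mul, mul_inv_cancel₀ hx0, AddValuation.map_one]
    obtain ⟨n', hn'⟩ := P.exists_int (inv_ne_zero hx0)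
    rw [map_zero, sub_zero, hn']
    rw [hn, hn'] at h1
    rw [hn] at hx
    norm_cast at *
    omega
  have h0 : p.reverse.eval 0 ≠ 0 := by
    rw [← coeff_zero_eq_eval_zero, coeff_zero_reverse]
    exact leadingCoeff_ne_zero.2 hp
  have hrev : aeval x p = aeval x⁻¹ p.reverse * x ^ p.natDegree := by
    let : Invertible x := invertibleOfNonzero hx0
    have := eval₂_reverse_mul_pow (algebraMap k F) x p
    rw [invOf_eq_inv] at this
    rw [aeval_def, aeval_def, this]
  rw [hrev, AddValuation.map_mul, P.aeval_eq_zero_of_eval_ne_zero hinv h0, zero_add,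
    AddValuation.map_pow]

end ValuationPolynomial

/-! ### Places have positive degree. -/

section Degree

variable {k F : Type*} [Field k] [Field F] [Algebra k F]

/-- Functions with linearly independent residues are linearly independent over `k[u]`, for every
`u` that vanishes at the place. -/
theorem Place.linearIndependent_of_residues [Algebra k[X] F] [IsScalarTower k k[X] F]
    [FaithfulSMul k[X] F]
    (Q : Place k F) (hu : 0 < Q.v (algebraMap k[X] F X)) {ι : Type*} [Fintype ι]
    (f : ι → Q.valuationRing)
    (hf : LinearIndependent k fun i => Ideal.Quotient.mk Q.maxIdeal (f i)) :
    LinearIndependent k[X] fun i => (f i : F) := by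
  have hCF : ∀ c : k, algebraMap k[X] F (C c) = algebraMap k F c := fun c =>
    (IsScalarTower.algebraMap_apply k k[X] F c).symm
  have hX0 : algebraMap k[X] F X ≠ 0 := by
    simp
  have haeval : ∀ p : k[X], algebraMap k[X] F p = aeval (algebraMap k[X] F X) p := fun p => by
    rw [aeval_algebraMap_apply, aeval_X_left_apply]
  have hnn : ∀ p : k[X], 0 ≤ Q.v (algebraMap k[X] F p) := fun p => by
    rw [haeval]
    exact Q.aeval_nonneg hu.le p
  -- Descent: in a relation, the constant coefficients vanish because the rest is `u` times an
  -- integral element and the residues are independent. Dividing by `u` gives another relation, so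
  -- every power of `X` divides the coefficients.
  have key : ∀ (n : ℕ) (p : ι → k[X]), ∑ i, p i • (f i : F) = 0 → ∀ i, X ^ n ∣ p i := by
    intro n
    induction n with
    | zero => intro p _ i; simp
    | succ n ih =>
      intro p hp
      have hc : ∀ i, (p i).coeff 0 = 0 := by
        refine Fintype.linearIndependent_iff.1 hf (fun i => (p i).coeff 0) ?_
        have hsum : ∑ i, (p i).coeff 0 • Ideal.Quotient.mk Q.maxIdeal (f i) =
            Ideal.Quotient.mk Q.maxIdeal (∑ i, (p i).coeff 0 • f i) := by
          rw [map_sum]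
          rfl
        rw [hsum, Ideal.Quotient.eq_zero_iff_mem]
        change 0 < Q.v ((∑ i, (p i).coeff 0 • f i : Q.valuationRing) : F)
        have hcoe : ((∑ i, (p i).coeff 0 • f i : Q.valuationRing) : F) =
            -(algebraMap k[X] F X * ∑ i, (p i).divX • (f i : F)) := by
          rw [eq_neg_iff_add_eq_zero, ← hp, Finset.mul_sum]
          push_cast
          rw [← Finset.sum_add_distrib]
          refine Finset.sum_congr rfl fun i _ => ?_
          conv_rhs => rw [← X_mul_divX_add (p i)]
          simp only [Algebra.smul_def, map_add, map_mul, hCF]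
          ring
        rw [hcoe, AddValuation.map_neg, AddValuation.map_mul]
        refine lt_of_lt_of_le hu (le_add_of_nonneg_right
          (AddValuation.map_le_sum _ fun i _ => ?_))
        rw [Algebra.smul_def, AddValuation.map_mul]
        exact add_nonneg (hnn _) (f i).2
      have hdvd : ∀ i, p i = X * (p i).divX := fun i => by
        conv_lhs => rw [← X_mul_divX_add (p i), hc i, C_0, add_zero]
      have := ih (fun i => (p i).divX) (by
        rw [← mul_right_inj' hX0, mul_zero, ← hp, Finset.mul_sum]
        refine Finset.sum_congr rfl fun i _ => ?_
        conv_rhs => rw [hdvd i]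
        rw [Algebra.smul_def, Algebra.smul_def, map_mul, mul_assoc])
      intro i
      rw [hdvd i, pow_succ']
      exact mul_dvd_mul_left X (this i)
  refine Fintype.linearIndependent_iff.2 fun p hp i => ?_
  by_contra hne
  have h1 := natDegree_le_of_dvd (key ((p i).natDegree + 1) p hp i) hne
  rw [natDegree_X_pow] at h1
  omega

/-- Lifts of independent residues are independent over `K`, so the residue field has dimension at
most `[F : K]`. This finiteness is what matters: `finrank` would be `0` for an infinite residue
extension. -/
theorem Place.degree_pos_of_finiteDimensional (K : Type*) [Field K] [Algebra k[X] K]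
    [IsFractionRing k[X] K] [Algebra k[X] F] [Algebra K F] [IsScalarTower k[X] K F]
    [IsScalarTower k k[X] F] [FaithfulSMul k[X] F] [FiniteDimensional K F] (Q : Place k F)
    (hu : 0 < Q.v (algebraMap k[X] F X)) : 0 < Q.degree := by
  have hone : (1 : Q.valuationRing) ∉ Q.maxIdeal := fun h => by
    have h' : 0 < Q.v (1 : F) := h
    simp at h'
  have : Nontrivial (Q.valuationRing ⧸ Q.maxIdeal) :=
    Ideal.Quotient.nontrivial_iff.2 ((Ideal.ne_top_iff_one _).2 hone)
  have : Module.Free k (Q.valuationRing ⧸ Q.maxIdeal) := Module.Free.of_divisionRing k _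
  have hrank : Module.rank k (Q.valuationRing ⧸ Q.maxIdeal) ≤ Module.finrank K F := by
    refine rank_le fun s hs => ?_
    choose g hg using fun i : s => Ideal.Quotient.mk_surjective (i : Q.valuationRing ⧸ Q.maxIdeal)
    have h1 := Q.linearIndependent_of_residues hu g (by simpa only [hg] using hs)
    rw [LinearIndependent.iff_fractionRing k[X] K] at h1
    exact (Fintype.card_coe s).symm.le.trans h1.fintype_card_le_finrank
  have : Module.Finite k (Q.valuationRing ⧸ Q.maxIdeal) :=
    Module.rank_lt_aleph0_iff.1 (hrank.trans_lt (Cardinal.natCast_lt_aleph0))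
  exact Module.finrank_pos

theorem adjoin_eq_top_of_subset (K : Type*) [Field K] [Algebra K F] {S T : Set F}
    (hS : IntermediateField.adjoin k S = ⊤)
    (hk : ∀ c : k, algebraMap k F c ∈ IntermediateField.adjoin K T)
    (hST : ∀ f ∈ S, f ∈ IntermediateField.adjoin K T) : IntermediateField.adjoin K T = ⊤ := by
  refine eq_top_iff.2 fun f _ => ?_
  have hf : f ∈ IntermediateField.adjoin k S := hS ▸ IntermediateField.mem_top
  induction hf using IntermediateField.adjoin_induction with
  | mem f hf => exact hST f hf
  | algebraMap c => exact hk c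
  | add f g _ _ hf hg => exact add_mem (hf trivial) (hg trivial)
  | mul f g _ _ hf hg => exact mul_mem (hf trivial) (hg trivial)
  | inv f _ hf => exact inv_mem (hf trivial)

/-- The transcendence degree is at most one, so any transcendental element is a transcendence basis.
-/
theorem isAlgebraic_adjoin_of_transcendental {x u : F}
    (hx : Algebra.IsAlgebraic (Algebra.adjoin k {x}) F) (hu : Transcendental k u) :
    Algebra.IsAlgebraic (Algebra.adjoin k {u}) F := by
  have htr : Algebra.trdeg k F ≤ Cardinal.mk ({u} : Set F) :=
    (Algebra.IsAlgebraic.trdeg_le_cardinalMk k {x}).trans (by simp)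
  have hind : AlgebraicIndependent k ((↑) : ({u} : Set F) → F) :=
    algebraicIndependent_unique_type_iff.2 hu
  have := (hind.isTranscendenceBasis_of_trdeg_le_of_finite htr).isAlgebraic
  rwa [Subtype.range_coe] at this

/-- Evaluation identifies `k[X]` with the subalgebra generated by the image of `X`. This links the
polynomial ring, used for finiteness over its fraction field, with the subalgebra, used for
transcendence degree. -/
theorem isAlgebraic_polynomial_iff [Algebra k[X] F] [IsScalarTower k k[X] F]
    [FaithfulSMul k[X] F] {f : F} :
    IsAlgebraic k[X] f ↔ IsAlgebraic (Algebra.adjoin k {algebraMap k[X] F X}) f := by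
  have haeval : ∀ p : k[X], algebraMap k[X] F p = aeval (algebraMap k[X] F X) p := fun p => by
    rw [aeval_algebraMap_apply, aeval_X_left_apply]
  let φ : k[X] →+* Algebra.adjoin k {algebraMap k[X] F X} :=
    (algebraMap k[X] F).codRestrict (Algebra.adjoin k {algebraMap k[X] F X}) fun p => by
      have h := aeval_mem_adjoin_singleton (p := p) k (algebraMap k[X] F X)
      rwa [← haeval p] at h
  have hφ : Function.Surjective φ := by
    rintro ⟨f, hf⟩
    rw [Algebra.adjoin_singleton_eq_range_aeval] at hf
    obtain ⟨p, rfl⟩ := hf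
    exact ⟨p, Subtype.ext (haeval p)⟩
  have hφ' : Function.Injective φ := fun p q h =>
    FaithfulSMul.algebraMap_injective k[X] F (congrArg Subtype.val h)
  exact ⟨fun h => h.ringHom_of_comp_eq φ (RingHom.id F) hφ' rfl,
    fun h => h.of_ringHom_of_comp_eq φ (RingHom.id F) hφ Function.injective_id rfl⟩

theorem finiteDimensional_of_adjoin_pair (K : Type*) [Field K] [Algebra k[X] K]
    [IsFractionRing k[X] K] [Algebra k[X] F] [Algebra K F] [IsScalarTower k[X] K F]
    [IsScalarTower k k[X] F] {x z : F} (hF : IntermediateField.adjoin k {x, z} = ⊤)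
    (hx : IsAlgebraic k[X] x) (hz : IsAlgebraic k[X] z) : FiniteDimensional K F := by
  have htop : IntermediateField.adjoin K {x, z} = ⊤ := by
    refine adjoin_eq_top_of_subset K hF (fun c => ?_) (fun f hf => ?_)
    · rw [IsScalarTower.algebraMap_apply k k[X] F, IsScalarTower.algebraMap_apply k[X] K F]
      exact IntermediateField.algebraMap_mem _ _
    · exact IntermediateField.subset_adjoin K _ hf
  have hKx : IsIntegral K x := (hx.extendScalars
    (IsFractionRing.injective k[X] K)).isIntegral
  have hKz : IsIntegral K z := (hz.extendScalars
    (IsFractionRing.injective k[X] K)).isIntegral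
  have : FiniteDimensional K (IntermediateField.adjoin K {x, z}) :=
    IntermediateField.finiteDimensional_adjoin (by
      rintro f (rfl | rfl)
      exacts [hKx, hKz])
  rw [htop] at this
  exact Module.Finite.equiv (IntermediateField.topEquiv (F := K) (E := F)).toLinearEquiv

/-- Take a uniformizer `u`. A nonzero polynomial in `u` has finite value, so `u` is transcendental.
Then `F` is algebraic over `k(u)` and generated by two elements, hence finite over it, and `u`
vanishes at the place. -/
theorem Place.degree_pos_of_adjoin_pair {x z : F} (hx : Transcendental k x)
    (hF : IntermediateField.adjoin k {x, z} = ⊤)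
    (hz : IsAlgebraic (Algebra.adjoin k {x}) z) (Q : Place k F) : 0 < Q.degree := by
  have hFx : Algebra.IsAlgebraic (Algebra.adjoin k {x}) F := by
    let : Algebra k[X] F := (aeval x).toAlgebra
    have hX : algebraMap k[X] F X = x := aeval_X x
    have : IsScalarTower k k[X] F := IsScalarTower.of_algebraMap_eq fun c => (aeval_C x c).symm
    have : FaithfulSMul k[X] F := (faithfulSMul_iff_algebraMap_injective _ _).2
      (transcendental_iff_injective.1 hx)
    let : Algebra (FractionRing k[X]) F := FractionRing.liftAlgebra k[X] F
    have := finiteDimensional_of_adjoin_pair (FractionRing k[X]) hF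
      (by rw [← hX]; exact isAlgebraic_algebraMap _)
      (isAlgebraic_polynomial_iff.2 (by rwa [hX]))
    refine ⟨fun f => ?_⟩
    have hf := (IsFractionRing.comap_isAlgebraic_iff (A := k[X]) (K := FractionRing k[X])).2
      (Algebra.IsAlgebraic.of_finite (FractionRing k[X]) F)
    have := isAlgebraic_polynomial_iff.1 (hf.isAlgebraic f)
    rwa [hX] at this
  obtain ⟨u, hu⟩ := Q.exists_eq 1
  have hu1 : 0 < Q.v u := by
    rw [hu]
    exact_mod_cast one_pos
  have hu0 : 0 < Q.v (u - algebraMap k F 0) := by rwa [map_zero, sub_zero]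
  have htr : Transcendental k u := by
    rw [transcendental_iff]
    intro p hp
    by_contra hne
    have := Q.aeval_eq_rootMultiplicity hu0 hne
    rw [hp, AddValuation.map_zero, map_zero, sub_zero, hu] at this
    norm_cast at this
  have hFu := isAlgebraic_adjoin_of_transcendental hFx htr
  let : Algebra k[X] F := (aeval u).toAlgebra
  have hX : algebraMap k[X] F X = u := aeval_X u
  have : IsScalarTower k k[X] F := IsScalarTower.of_algebraMap_eq fun c => (aeval_C u c).symm
  have : FaithfulSMul k[X] F := (faithfulSMul_iff_algebraMap_injective _ _).2
    (transcendental_iff_injective.1 htr)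
  let : Algebra (FractionRing k[X]) F := FractionRing.liftAlgebra k[X] F
  have halg : ∀ f : F, IsAlgebraic k[X] f := fun f =>
    isAlgebraic_polynomial_iff.2 (by rw [hX]; exact hFu.isAlgebraic f)
  have := finiteDimensional_of_adjoin_pair (FractionRing k[X]) hF (halg x) (halg z)
  exact Q.degree_pos_of_finiteDimensional (FractionRing k[X]) (by rwa [hX])

end Degree

/-! ### Sums of terms with distinct values. -/

section DistinctValues

variable {F : Type*} [Field F]

theorem map_sum_eq_inf_of_pairwise_ne (v : AddValuation F (WithTop ℤ)) {ι : Type*} [Fintype ι]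
    (a : ι → F) (ha : ∀ i j, i ≠ j → a i ≠ 0 → a j ≠ 0 → v (a i) ≠ v (a j)) :
    v (∑ i, a i) = Finset.univ.inf fun i => v (a i) := by
  classical
  by_cases h0 : ∀ i, a i = 0
  · simp [h0]
  push Not at h0
  obtain ⟨i₀, hi₀⟩ := h0
  have hne : (Finset.univ : Finset ι).Nonempty := ⟨i₀, Finset.mem_univ _⟩
  obtain ⟨j, -, hj⟩ := Finset.exists_mem_eq_inf Finset.univ hne fun i => v (a i)
  have hle : ∀ i, v (a j) ≤ v (a i) := fun i => hj ▸ Finset.inf_le (Finset.mem_univ i)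
  have hjtop : v (a j) ≠ ⊤ :=
    ((hle i₀).trans_lt (lt_top_iff_ne_top.2 ((AddValuation.ne_top_iff v).2 hi₀))).ne
  have hj0 : a j ≠ 0 := (AddValuation.ne_top_iff v).1 hjtop
  rw [hj, ← Finset.add_sum_erase _ _ (Finset.mem_univ j)]
  refine AddValuation.map_add_eq_of_lt_left v (AddValuation.map_lt_sum v hjtop fun i hi => ?_)
  by_cases hi0 : a i = 0
  · rw [hi0, AddValuation.map_zero]
    exact lt_top_iff_ne_top.2 hjtop
  · exact lt_of_le_of_ne (hle i) (ha j i (Finset.ne_of_mem_erase hi).symm hj0 hi0)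

end DistinctValues

/-! ### Total ramification from orders in distinct classes modulo `m`. -/

section TotalRamification

variable {k F : Type*} [Field k] [Field F] [Algebra k F]

theorem Place.zpow_eq (P : Place k F) {f : F} {c : ℤ} (hf : P.v f = c) (n : ℤ) :
    P.v (f ^ n) = ((n * c : ℤ) : WithTop ℤ) := by
  have hf0 : f ≠ 0 := by
    rintro rfl
    simp at hf
  have hpow : ∀ l : ℕ, P.v (f ^ l) = ((l * c : ℤ) : WithTop ℤ) := fun l => by
    rw [AddValuation.map_pow, hf, ← WithTop.coe_nsmul, nsmul_eq_mul]
  obtain ⟨l, rfl | rfl⟩ := n.eq_nat_or_neg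
  · rw [zpow_natCast, hpow]
  · obtain ⟨d, hd⟩ := P.exists_int (zpow_ne_zero (-(l : ℤ)) hf0)
    have h1 : P.v (f ^ (-(l : ℤ))) + P.v (f ^ l) = 0 := by
      rw [← AddValuation.map_mul, ← zpow_natCast, ← zpow_add₀ hf0]
      simp
    rw [hd, hpow] at h1
    rw [hd]
    norm_cast at *
    linarith

theorem Place.eq_of_v_eq {P Q : Place k F} (h : P.v = Q.v) : P = Q := by
  cases P
  cases Q
  simp only at h
  subst h
  rfl

variable {m : ℕ} {x z : F} {ord : k[X] → ℤ} {c : ℤ}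

theorem Place.map_aeval_mul_pow (P : Place k F) {e : ℤ} (hz : P.v z = ((e * c : ℤ) : WithTop ℤ))
    (hord : ∀ p : k[X], p ≠ 0 → P.v (aeval x p) = ((e * (m * ord p) : ℤ) : WithTop ℤ))
    {p : k[X]} (hp : p ≠ 0) (i : ℕ) :
    P.v (aeval x p * z ^ i) = ((e * (m * ord p + i * c) : ℤ) : WithTop ℤ) := by
  rw [AddValuation.map_mul, hord p hp, ← zpow_natCast, P.zpow_eq hz, ← WithTop.coe_add]
  congr 1
  ring

/-- The terms `p i (x) * z ^ i`, for `i < m`, have pairwise distinct values, as these lie in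
different residue classes modulo `m`. -/
theorem Place.map_sum_aeval_mul_pow (P : Place k F) (hc : IsCoprime (m : ℤ) c) {e : ℤ} (he : e ≠ 0)
    (hz : P.v z = ((e * c : ℤ) : WithTop ℤ))
    (hord : ∀ p : k[X], p ≠ 0 → P.v (aeval x p) = ((e * (m * ord p) : ℤ) : WithTop ℤ))
    (p : Fin m → k[X]) :
    P.v (∑ i, aeval x (p i) * z ^ (i : ℕ)) =
      Finset.univ.inf fun i : Fin m => P.v (aeval x (p i) * z ^ (i : ℕ)) := by
  refine map_sum_eq_inf_of_pairwise_ne P.v _ fun i j hij hi hj h => hij ?_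
  have hpi : p i ≠ 0 := by
    intro h0
    simp [h0] at hi
  have hpj : p j ≠ 0 := by
    intro h0
    simp [h0] at hj
  rw [P.map_aeval_mul_pow hz hord hpi, P.map_aeval_mul_pow hz hord hpj, WithTop.coe_inj,
    mul_right_inj' he] at h
  have hdvd : (m : ℤ) ∣ ((i : ℕ) : ℤ) - ((j : ℕ) : ℤ) :=
    hc.dvd_of_dvd_mul_right ⟨ord (p j) - ord (p i), by linear_combination h⟩
  have h2 : ((i : ℕ) : ℤ) % m = ((j : ℕ) : ℤ) % m :=
    Int.emod_eq_emod_iff_emod_sub_eq_zero.2 (Int.emod_eq_zero_of_dvd hdvd)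
  rw [← Int.natCast_mod, ← Int.natCast_mod, Nat.mod_eq_of_lt i.2, Nat.mod_eq_of_lt j.2] at h2
  exact Fin.ext (by exact_mod_cast h2)

/-- A function expands with a denominator whose value is a multiple of `e`, and the sum takes the
value of one of its terms, again a multiple of `e`. A function of value `1` then forces `e ∣ 1`. -/
theorem Place.ramification_eq_one (P : Place k F) (hc : IsCoprime (m : ℤ) c) {e : ℤ} (he : 0 < e)
    (hz : P.v z = ((e * c : ℤ) : WithTop ℤ))
    (hord : ∀ p : k[X], p ≠ 0 → P.v (aeval x p) = ((e * (m * ord p) : ℤ) : WithTop ℤ))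
    (hspan : ∀ f : F, ∃ (q : k[X]) (p : Fin m → k[X]), q ≠ 0 ∧
      aeval x q * f = ∑ i, aeval x (p i) * z ^ (i : ℕ)) : e = 1 := by
  obtain ⟨f, hf⟩ := P.exists_eq 1
  obtain ⟨q, p, hq, hqp⟩ := hspan f
  have h := P.map_sum_aeval_mul_pow hc he.ne' hz hord p
  rw [← hqp, AddValuation.map_mul, hf, hord q hq, ← WithTop.coe_add] at h
  have hne : (Finset.univ : Finset (Fin m)).Nonempty := by
    by_contra hemp
    rw [Finset.not_nonempty_iff_eq_empty] at hemp
    rw [hemp, Finset.inf_empty] at h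
    exact WithTop.coe_ne_top h
  obtain ⟨i, -, hi⟩ := Finset.exists_mem_eq_inf _ hne
    fun i : Fin m => P.v (aeval x (p i) * z ^ (i : ℕ))
  rw [hi] at h
  have hpi : p i ≠ 0 := by
    intro h0
    rw [h0, map_zero, zero_mul, AddValuation.map_zero] at h
    exact WithTop.coe_ne_top h
  rw [P.map_aeval_mul_pow hz hord hpi, WithTop.coe_inj] at h
  exact Int.eq_one_of_dvd_one he.le
    ⟨m * ord (p i) + (i : ℕ) * c - m * ord q, by linear_combination h⟩

/-- The value of any function is read off from its expansion as a minimum, so it depends only on the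
orders of `z` and of polynomials in `x`. -/
theorem Place.eq_of_orders_eq {P Q : Place k F} (hc : IsCoprime (m : ℤ) c)
    (hzP : P.v z = (c : WithTop ℤ)) (hzQ : Q.v z = (c : WithTop ℤ))
    (hP : ∀ p : k[X], p ≠ 0 → P.v (aeval x p) = ((m * ord p : ℤ) : WithTop ℤ))
    (hQ : ∀ p : k[X], p ≠ 0 → Q.v (aeval x p) = ((m * ord p : ℤ) : WithTop ℤ))
    (hspan : ∀ f : F, ∃ (q : k[X]) (p : Fin m → k[X]), q ≠ 0 ∧
      aeval x q * f = ∑ i, aeval x (p i) * z ^ (i : ℕ)) : P = Q := by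
  refine Place.eq_of_v_eq (AddValuation.ext fun f => ?_)
  obtain ⟨q, p, hq, hqp⟩ := hspan f
  have h1 := P.map_sum_aeval_mul_pow (e := 1) hc one_ne_zero (by simpa using hzP)
    (by simpa only [one_mul] using hP) p
  have h2 := Q.map_sum_aeval_mul_pow (e := 1) hc one_ne_zero (by simpa using hzQ)
    (by simpa only [one_mul] using hQ) p
  have h3 : ∀ i, P.v (aeval x (p i) * z ^ (i : ℕ)) = Q.v (aeval x (p i) * z ^ (i : ℕ)) :=
    fun i => by
      by_cases hp : p i = 0
      · simp [hp]
      · rw [AddValuation.map_mul, AddValuation.map_mul, hP _ hp, hQ _ hp, AddValuation.map_pow,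
          AddValuation.map_pow, hzP, hzQ]
  rw [← hqp, AddValuation.map_mul, hP q hq] at h1
  rw [← hqp, AddValuation.map_mul, hQ q hq] at h2
  simp only [h3] at h1
  exact (WithTop.add_left_inj WithTop.coe_ne_top).1 (h1.trans h2.symm)

/-- A place over a simple zero of `h` is totally ramified in `z ^ m = h(x)`. -/
theorem Place.orders_at_zero (P : Place k F) (hm : m ≠ 0) {h g : k[X]} {a : k}
    (hh : h = (X - C a) * g) (hg : g.eval a ≠ 0) (hz : z ^ m = aeval x h)
    (hspan : ∀ f : F, ∃ (q : k[X]) (p : Fin m → k[X]), q ≠ 0 ∧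
      aeval x q * f = ∑ i, aeval x (p i) * z ^ (i : ℕ))
    (hP : 0 < P.v (x - algebraMap k F a)) (hx : Transcendental k x) :
    P.v z = ((1 : ℤ) : WithTop ℤ) ∧ ∀ p : k[X], p ≠ 0 →
      P.v (aeval x p) = ((m * p.rootMultiplicity a : ℤ) : WithTop ℤ) := by
  have hxa : x - algebraMap k F a ≠ 0 := by
    intro h0
    have := (transcendental_iff.1 hx) (X - C a) (by simpa using h0)
    exact X_sub_C_ne_zero a this
  have hvh : m • P.v z = P.v (x - algebraMap k F a) := by
    rw [← AddValuation.map_pow, hz, hh, map_mul, AddValuation.map_mul,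
      P.aeval_eq_zero_of_eval_ne_zero hP hg, add_zero]
    simp
  have hz0 : z ≠ 0 := by
    rintro rfl
    obtain ⟨b, hb⟩ := P.exists_int hxa
    rw [AddValuation.map_zero, hb] at hvh
    obtain ⟨m', rfl⟩ := Nat.exists_eq_succ_of_ne_zero hm
    simp [succ_nsmul] at hvh
  obtain ⟨e, he⟩ := P.exists_int hz0
  rw [he, ← WithTop.coe_nsmul, nsmul_eq_mul] at hvh
  have hepos : 0 < e := by
    rw [← hvh] at hP
    have : (0 : ℤ) < m * e := by exact_mod_cast hP
    exact pos_of_mul_pos_right this (Int.natCast_nonneg m)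
  have hord : ∀ p : k[X], p ≠ 0 →
      P.v (aeval x p) = ((e * (m * p.rootMultiplicity a) : ℤ) : WithTop ℤ) := fun p hp => by
    rw [P.aeval_eq_rootMultiplicity hP hp, ← hvh, ← WithTop.coe_nsmul, nsmul_eq_mul]
    congr 1
    ring
  -- Since `m * v(z) = v(x - a)`, the factor `e = v(z)` divides all the known orders.
  have he1 : e = 1 := P.ramification_eq_one (c := 1) (ord := fun p => p.rootMultiplicity a)
    isCoprime_one_right hepos (by simpa using he) hord hspan
  subst he1
  exact ⟨he, by simpa only [one_mul] using hord⟩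

/-- The place at infinity is totally ramified in `z ^ m = h(x)` if `m` is prime to `deg h`. -/
theorem Place.orders_at_infinity (P : Place k F) (hm : m ≠ 0) {h : k[X]} (hh : h ≠ 0)
    (hcop : IsCoprime (m : ℤ) h.natDegree) (hz : z ^ m = aeval x h)
    (hspan : ∀ f : F, ∃ (q : k[X]) (p : Fin m → k[X]), q ≠ 0 ∧
      aeval x q * f = ∑ i, aeval x (p i) * z ^ (i : ℕ))
    (hP : P.v x < 0) :
    P.v z = ((-h.natDegree : ℤ) : WithTop ℤ) ∧ ∀ p : k[X], p ≠ 0 →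
      P.v (aeval x p) = ((m * -p.natDegree : ℤ) : WithTop ℤ) := by
  have hx0 : x ≠ 0 := by
    rintro rfl
    simp at hP
  obtain ⟨b, hb⟩ := P.exists_int hx0
  have hvh : m • P.v z = ((h.natDegree * b : ℤ) : WithTop ℤ) := by
    rw [← AddValuation.map_pow, hz, P.aeval_eq_natDegree hP hh, hb, ← WithTop.coe_nsmul,
      nsmul_eq_mul]
  have hz0 : z ≠ 0 := by
    rintro rfl
    rw [AddValuation.map_zero] at hvh
    obtain ⟨m', rfl⟩ := Nat.exists_eq_succ_of_ne_zero hm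
    simp [succ_nsmul] at hvh
    exact WithTop.coe_ne_top (by exact_mod_cast hvh.symm)
  obtain ⟨d, hd⟩ := P.exists_int hz0
  rw [hd, ← WithTop.coe_nsmul, nsmul_eq_mul, WithTop.coe_inj] at hvh
  -- Here `m * v(z) = deg h * v(x)` with `m` prime to `deg h`. The resulting `e` is negative, so
  -- `-e` plays the role of the ramification factor.
  obtain ⟨e, rfl⟩ : (m : ℤ) ∣ b := hcop.dvd_of_dvd_mul_left ⟨d, hvh.symm⟩
  have hm' : (0 : ℤ) < m := by exact_mod_cast Nat.pos_of_ne_zero hm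
  have hd' : d = -e * -h.natDegree := by
    have h1 : (m : ℤ) * d = m * (-e * -h.natDegree) := by linear_combination hvh
    exact mul_left_cancel₀ hm'.ne' h1
  have hepos : 0 < -e := by
    rw [hb] at hP
    have h1 : (m : ℤ) * e < 0 := by exact_mod_cast hP
    have := neg_of_mul_neg_right h1 hm'.le
    linarith
  have hord : ∀ p : k[X], p ≠ 0 →
      P.v (aeval x p) = ((-e * (m * -p.natDegree) : ℤ) : WithTop ℤ) := fun p hp => by
    rw [P.aeval_eq_natDegree hP hp, hb, ← WithTop.coe_nsmul, nsmul_eq_mul]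
    congr 1
    ring
  have he1 : -e = 1 := P.ramification_eq_one (c := -h.natDegree) (ord := fun p => -p.natDegree)
    hcop.neg_right hepos (by rw [hd, hd']) hord hspan
  rw [hd, hd', he1, one_mul]
  exact ⟨rfl, by simpa only [he1, one_mul] using hord⟩

end TotalRamification

/-! ### Combinatorics of `Ω`. -/

section LatticePoints

variable {m n : ℕ}

/-- The order at the `μ`-th place over a finite point of the function attached to a lattice
point. -/
def latticeOrder (m : ℕ) {n : ℕ} (w : ℤ × (Fin n → ℤ)) : Fin (n + 1) → ℤ :=
  Fin.cons w.1 fun a => w.1 + m * w.2 a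

/-- The pole order at infinity of the function attached to a lattice point. -/
def latticePole (m : ℕ) {n : ℕ} (w : ℤ × (Fin n → ℤ)) : ℤ :=
  ((n + 1 : ℕ) : ℤ) * w.1 + m * ∑ a, w.2 a

theorem neg_le_latticeOrder {s : Fin (n + 1) → ℤ} {t : ℤ} {w : ℤ × (Fin n → ℤ)}
    (hw : w ∈ latticeOmega m s t) (μ : Fin (n + 1)) : -s μ ≤ latticeOrder m w μ := by
  obtain ⟨h0, h1, -⟩ := hw
  refine Fin.cases ?_ (fun a => ?_) μ
  · simp only [latticeOrder, Fin.cons_zero]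
    linarith
  · simp only [latticeOrder, Fin.cons_succ]
    linarith [(h1 a).1]

/-- The lattice point with first coordinate `i` whose orders at the other places over finite
points are the least ones that are allowed. -/
def latticePoint (m : ℕ) {n : ℕ} (s : Fin (n + 1) → ℤ) (i : ℤ) : ℤ × (Fin n → ℤ) :=
  (i, fun a => -((i + s a.succ) / m))

theorem latticePoint_order (s : Fin (n + 1) → ℤ) (i : ℤ) (a : Fin n) :
    (latticePoint m s i).1 + m * (latticePoint m s i).2 a = (i + s a.succ) % m - s a.succ := by
  have := Int.emod_add_mul_ediv (i + s a.succ) m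
  simp only [latticePoint]
  linarith

theorem latticePole_latticePoint (s : Fin (n + 1) → ℤ) (i : ℤ) :
    latticePole m (latticePoint m s i) = i + ∑ a : Fin n, ((i + s a.succ) % m - s a.succ) := by
  simp only [← latticePoint_order, latticePole, Finset.sum_add_distrib, Finset.mul_sum]
  simp [latticePoint]
  ring

theorem latticePoint_mem_iff (hm : m ≠ 0) (s : Fin (n + 1) → ℤ) (t i : ℤ) :
    latticePoint m s i ∈ latticeOmega m s t ↔
      0 ≤ i + s 0 ∧ latticePole m (latticePoint m s i) ≤ t := by
  have hm' : (0 : ℤ) < m := by exact_mod_cast Nat.pos_of_ne_zero hm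
  refine ⟨fun h => ⟨h.1, h.2.2⟩, fun h => ⟨h.1, fun a => ?_, h.2⟩⟩
  rw [latticePoint_order, sub_add_cancel]
  exact ⟨Int.emod_nonneg _ hm'.ne', Int.emod_lt_of_pos _ hm'⟩

/-- Orders `V μ` in one residue class modulo `m` and a pole order `T` that satisfy the degree
inequality are bounded by the orders of lattice points. -/
theorem exists_lattice_points (hm : m ≠ 0) {s : Fin (n + 1) → ℤ} {t : ℤ} {V : Fin (n + 1) → ℤ}
    {T : ℤ} (hV : ∀ μ, -s μ ≤ V μ) (hT : T ≤ t) (hVT : ∑ μ, V μ ≤ T)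
    (hmod : ∀ μ, V μ ≡ V 0 [ZMOD m]) (hTmod : T ≡ ((n + 1 : ℕ) : ℤ) * V 0 [ZMOD m]) :
    (∃ w ∈ latticeOmega m s t, ∀ μ, latticeOrder m w μ ≤ V μ) ∧
      ∃ w ∈ latticeOmega m s t, latticePole m w = T := by
  have hm' : (0 : ℤ) < m := by exact_mod_cast Nat.pos_of_ne_zero hm
  -- `ρ a` is the least integer that is at least `-s a.succ` and congruent to `V 0` modulo `m`;
  -- hence `ρ a ≤ V a.succ`.
  set ρ : Fin n → ℤ := fun a => (V 0 + s a.succ) % m - s a.succ with hρ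
  have hρV : ∀ a, ρ a ≤ V a.succ := fun a => by
    have h1 : (V 0 + s a.succ) % m = (V a.succ + s a.succ) % m :=
      ((hmod a.succ).symm.add_right _)
    have h2 : (V a.succ + s a.succ) % m ≤ V a.succ + s a.succ := by
      have h3 := Int.emod_add_mul_ediv (V a.succ + s a.succ) m
      have h4 : 0 ≤ (V a.succ + s a.succ) / m :=
        Int.ediv_nonneg (by linarith [hV a.succ]) hm'.le
      linarith [mul_nonneg hm'.le h4]
    simp only [hρ]
    linarith
  have hρmod : ∀ a, ρ a ≡ V 0 [ZMOD m] := fun a => by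
    have h1 : (V 0 + s a.succ) % m ≡ V 0 + s a.succ [ZMOD m] := Int.mod_modEq _ _
    simpa [hρ] using h1.sub_right (s a.succ)
  have hsum : V 0 + ∑ a, ρ a ≤ T := by
    rw [Fin.sum_univ_succ] at hVT
    linarith [Finset.sum_le_sum fun a (_ : a ∈ Finset.univ) => hρV a]
  have hpole : ∀ i, i ≡ V 0 [ZMOD m] →
      latticePole m (latticePoint m s i) = i + ∑ a, ρ a := fun i hi => by
    rw [latticePole_latticePoint]
    congr 1
    refine Finset.sum_congr rfl fun a _ => ?_
    simp only [hρ]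
    rw [(hi.add_right (s a.succ)).eq]
  -- The first point has the minimal orders `ρ` and pole order `V 0 + ∑ ρ ≤ T`. The second puts all
  -- the slack into the first coordinate: as `T ≡ (n + 1) V 0` and `∑ ρ ≡ n V 0`, the number `T - ∑
  -- ρ` is still congruent to `V 0`, so the orders `ρ` are unchanged and the pole order becomes
  -- exactly `T`.
  refine ⟨⟨latticePoint m s (V 0), ?_, fun μ => ?_⟩,
    latticePoint m s (T - ∑ a, ρ a), ?_, ?_⟩
  · rw [latticePoint_mem_iff hm, hpole _ rfl]
    exact ⟨by linarith [hV 0], hsum.trans hT⟩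
  · refine Fin.cases ?_ (fun a => ?_) μ
    · simp [latticeOrder, latticePoint]
    · simp only [latticeOrder, Fin.cons_succ]
      rw [latticePoint_order]
      exact hρV a
  all_goals
    have hi : T - ∑ a, ρ a ≡ V 0 [ZMOD m] := by
      have h1 : ∑ a, ρ a ≡ ∑ _a : Fin n, V 0 [ZMOD m] := Int.ModEq.sum fun a _ => hρmod a
      have h2 := hTmod.sub h1
      have h3 : ((n + 1 : ℕ) : ℤ) * V 0 - ∑ _a : Fin n, V 0 = V 0 := by
        simp
        ring
      rwa [h3] at h2
  · rw [latticePoint_mem_iff hm, hpole _ hi]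
    exact ⟨by linarith [hV 0], by linarith⟩
  · rw [hpole _ hi]
    ring

theorem exists_isGreatest_of_subset_Iic {S : Set ℤ} {b : ℤ} (hS : S.Nonempty)
    (hb : ∀ c ∈ S, c ≤ b) : ∃ c, IsGreatest S c :=
  ⟨sSup S, Int.csSup_mem hS ⟨b, hb⟩, fun _ hc => le_csSup ⟨b, hb⟩ hc⟩

end LatticePoints

/-! ### A criterion for the floor. -/

section Floor

variable {k F : Type*} [Field k] [Field F] [Algebra k F] {n : ℕ} {P : Fin n → Place k F}
  {Pinf : Place k F}

theorem kummerDivisor_apply_of_ne (s : Fin n → ℤ) (t : ℤ) {Q : Place k F} (hQ : ∀ μ, Q ≠ P μ)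
    (hQ' : Q ≠ Pinf) : kummerDivisor P Pinf s t Q = 0 := by
  simp only [kummerDivisor, Finsupp.add_apply, Finsupp.finsetSum_apply]
  rw [Finsupp.single_eq_of_ne hQ', add_zero]
  exact Finset.sum_eq_zero fun μ _ => Finsupp.single_eq_of_ne (hQ μ)

theorem kummerDivisor_apply_infinity (s : Fin n → ℤ) (t : ℤ) (hP' : ∀ μ, P μ ≠ Pinf) :
    kummerDivisor P Pinf s t Pinf = t := by
  simp only [kummerDivisor, Finsupp.add_apply, Finsupp.finsetSum_apply, Finsupp.single_eq_same]
  rw [Finset.sum_eq_zero fun μ _ => Finsupp.single_eq_of_ne (hP' μ).symm, zero_add]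

theorem kummerDivisor_apply (s : Fin n → ℤ) (t : ℤ) (hP : Function.Injective P)
    (hP' : ∀ μ, P μ ≠ Pinf) (μ : Fin n) : kummerDivisor P Pinf s t (P μ) = s μ := by
  simp only [kummerDivisor, Finsupp.add_apply, Finsupp.finsetSum_apply]
  rw [Finsupp.single_eq_of_ne (hP' μ), add_zero, Finset.sum_eq_single μ, Finsupp.single_eq_same]
  · exact fun ν _ hν => Finsupp.single_eq_of_ne (hP.ne hν.symm)
  · simp

theorem mem_riemannRochSpace_kummerDivisor (s : Fin n → ℤ) (t : ℤ) (hP : Function.Injective P)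
    (hP' : ∀ μ, P μ ≠ Pinf) {f : F} :
    f ∈ riemannRochSpace (kummerDivisor P Pinf s t) ↔
      (∀ μ, ((-s μ : ℤ) : WithTop ℤ) ≤ (P μ).v f) ∧ ((-t : ℤ) : WithTop ℤ) ≤ Pinf.v f ∧
        ∀ Q : Place k F, (∀ μ, Q ≠ P μ) → Q ≠ Pinf → 0 ≤ Q.v f := by
  refine ⟨fun h => ⟨fun μ => ?_, ?_, fun Q hQ hQ' => ?_⟩, fun h Q => ?_⟩
  · have := h (P μ)
    rwa [kummerDivisor_apply s t hP hP'] at this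
  · have := h Pinf
    rwa [kummerDivisor_apply_infinity s t hP'] at this
  · have := h Q
    rwa [kummerDivisor_apply_of_ne s t hQ hQ', neg_zero] at this
  · by_cases hQ : ∃ μ, Q = P μ
    · obtain ⟨μ, rfl⟩ := hQ
      rw [kummerDivisor_apply s t hP hP']
      exact h.1 μ
    · push Not at hQ
      by_cases hQ' : Q = Pinf
      · subst hQ'
        rw [kummerDivisor_apply_infinity s t hP']
        exact h.2.1
      · rw [kummerDivisor_apply_of_ne s t hQ hQ', neg_zero]
        exact h.2.2 Q hQ hQ'

theorem Divisor.degree_sub (D E : Divisor k F) : (D - E).degree = D.degree - E.degree :=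
  Finsupp.sum_sub_index fun _ _ _ => sub_mul _ _ _

theorem Divisor.degree_nonneg {D : Divisor k F} (hD : 0 ≤ D) : 0 ≤ D.degree :=
  Finset.sum_nonneg fun Q _ => mul_nonneg (hD Q) (Int.natCast_nonneg _)

theorem Divisor.eq_zero_of_degree_nonpos (hdeg : ∀ Q : Place k F, 0 < Q.degree)
    {D : Divisor k F} (hD : 0 ≤ D) (h : D.degree ≤ 0) : D = 0 := by
  have h0 : D.degree = 0 := le_antisymm h (Divisor.degree_nonneg hD)
  ext Q
  by_contra hQ
  have := (Finset.sum_eq_zero_iff_of_nonneg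
    fun Q _ => mul_nonneg (hD Q) (Int.natCast_nonneg Q.degree)).1 h0 Q
      (Finsupp.mem_support_iff.2 hQ)
  rcases mul_eq_zero.1 this with h1 | h1
  · exact hQ h1
  · exact (hdeg Q).ne' (by exact_mod_cast h1)

/-- The least divisor with a given Riemann-Roch space is the floor. -/
theorem isFloor_of_forall_le (hdeg : ∀ Q : Place k F, 0 < Q.degree) {G D : Divisor k F}
    (hGD : riemannRochSpace G = riemannRochSpace D)
    (hle : ∀ D' : Divisor k F, riemannRochSpace G = riemannRochSpace D' → D ≤ D') :
    IsFloor G D := by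
  refine ⟨⟨hGD, fun D' hD' => ?_⟩, fun D' hD' => ?_⟩
  · have := Divisor.degree_nonneg (sub_nonneg.2 (hle D' hD'))
    rw [Divisor.degree_sub] at this
    linarith
  -- A divisor of minimal degree dominates `D`, and its degree is at most that of `D`; an effective
  -- difference of degree at most zero vanishes.
  · refine sub_eq_zero.1 (Divisor.eq_zero_of_degree_nonpos hdeg
      (sub_nonneg.2 (hle D' hD'.1)) ?_)
    rw [Divisor.degree_sub]
    linarith [hD'.2 D hGD]

theorem le_of_mem_riemannRochSpace {D : Divisor k F} {f : F} (hf : f ∈ riemannRochSpace D)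
    {Q : Place k F} {c : ℤ} (hQ : Q.v f = ((-c : ℤ) : WithTop ℤ)) : c ≤ D Q := by
  have := hf Q
  rw [hQ, WithTop.coe_le_coe] at this
  linarith

/-- Each coefficient of the candidate, including the zeros at the other places, is attained by a
function in the space. A divisor with the same space must therefore dominate the candidate at every
place, which is stronger than comparing degrees. -/
theorem isFloor_kummerDivisor (hdeg : ∀ Q : Place k F, 0 < Q.degree)
    (hP : Function.Injective P) (hP' : ∀ μ, P μ ≠ Pinf) {s s' : Fin n → ℤ} {t t' : ℤ}
    (hs : ∀ μ, s' μ ≤ s μ) (ht : t' ≤ t)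
    (hL : ∀ f ∈ riemannRochSpace (kummerDivisor P Pinf s t), f ≠ 0 →
      (∀ μ, ((-s' μ : ℤ) : WithTop ℤ) ≤ (P μ).v f) ∧ ((-t' : ℤ) : WithTop ℤ) ≤ Pinf.v f)
    (hE : ∀ μ, ∃ f ∈ riemannRochSpace (kummerDivisor P Pinf s t),
      (P μ).v f = ((-s' μ : ℤ) : WithTop ℤ))
    (hEinf : ∃ f ∈ riemannRochSpace (kummerDivisor P Pinf s t),
      Pinf.v f = ((-t' : ℤ) : WithTop ℤ))
    (hE' : ∀ Q : Place k F, (∀ μ, Q ≠ P μ) → Q ≠ Pinf →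
      ∃ f ∈ riemannRochSpace (kummerDivisor P Pinf s t), Q.v f = 0) :
    IsFloor (kummerDivisor P Pinf s t) (kummerDivisor P Pinf s' t') := by
  refine isFloor_of_forall_le hdeg (le_antisymm (fun f hf => ?_) (fun f hf => ?_))
    (fun D hD Q => ?_)
  · by_cases hf0 : f = 0
    · rw [hf0]
      exact zero_mem _
    have hf' := (mem_riemannRochSpace_kummerDivisor s t hP hP').1 hf
    obtain ⟨h1, h2⟩ := hL f hf hf0
    exact (mem_riemannRochSpace_kummerDivisor s' t' hP hP').2 ⟨h1, h2, hf'.2.2⟩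
  · obtain ⟨h1, h2, h3⟩ := (mem_riemannRochSpace_kummerDivisor s' t' hP hP').1 hf
    refine (mem_riemannRochSpace_kummerDivisor s t hP hP').2
      ⟨fun μ => le_trans ?_ (h1 μ), le_trans ?_ h2, h3⟩
    · exact WithTop.coe_le_coe.2 (neg_le_neg (hs μ))
    · exact WithTop.coe_le_coe.2 (neg_le_neg ht)
  · by_cases hQ : ∃ μ, Q = P μ
    · obtain ⟨μ, rfl⟩ := hQ
      obtain ⟨f, hf, hfv⟩ := hE μ
      rw [kummerDivisor_apply s' t' hP hP']
      exact le_of_mem_riemannRochSpace (hD ▸ hf) hfv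
    · push Not at hQ
      by_cases hQ' : Q = Pinf
      · subst hQ'
        obtain ⟨f, hf, hfv⟩ := hEinf
        rw [kummerDivisor_apply_infinity s' t' hP']
        exact le_of_mem_riemannRochSpace (hD ▸ hf) hfv
      · obtain ⟨f, hf, hfv⟩ := hE' Q hQ hQ'
        rw [kummerDivisor_apply_of_ne s' t' hQ hQ']
        exact le_of_mem_riemannRochSpace (c := 0) (hD ▸ hf) (by rw [hfv]; rfl)

end Floor

/-! ### Normalizing the Kummer generator, and expansions in its powers. -/

section Kummer

variable {k F : Type*} [Field k] [Field F] [Algebra k F]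

/-- With `b m + a l = 1`, take `z = y ^ a * H ^ b`; both identities follow from `y ^ m = H ^ l`. -/
theorem exists_pow_eq_of_pow_eq_zpow {m : ℕ} {l : ℤ} (hml : IsCoprime (m : ℤ) l) {y H : F}
    (hm : m ≠ 0) (hH : H ≠ 0) (hy : y ^ m = H ^ l) : ∃ z : F, z ^ m = H ∧ y = z ^ l := by
  obtain ⟨b, a, hab⟩ := hml
  have hy0 : y ≠ 0 := by
    rintro rfl
    rw [zero_pow hm] at hy
    exact zpow_ne_zero l hH hy.symm
  have hy' : y ^ (m : ℤ) = H ^ l := by rw [zpow_natCast, hy]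
  refine ⟨y ^ a * H ^ b, ?_, ?_⟩
  · rw [mul_pow, ← zpow_natCast, ← zpow_natCast, ← zpow_mul, ← zpow_mul, mul_comm a, zpow_mul, hy',
      ← zpow_mul, ← zpow_add₀ hH]
    conv_rhs => rw [← zpow_one H, ← hab]
    congr 1
    ring
  · rw [mul_zpow, ← zpow_mul, ← zpow_mul, mul_comm b l, zpow_mul H, ← hy', ← zpow_mul,
      ← zpow_add₀ hy0]
    conv_lhs => rw [← zpow_one y, ← hab]
    congr 1
    ring

/-- The first expansion, with an arbitrary denominator, is enough to determine places and their
ramification. The second, for functions integral over `k[x]`, keeps the denominator a power of `h`;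
the degree comparison in `IsKummer.exists_lattice_le` depends on this. -/
theorem exists_expansions {m : ℕ} (hm : (m : k) ≠ 0) {h g : k[X]} {a : k}
    (hh : h = (X - C a) * g) (hg : g.eval a ≠ 0) {x z : F} (hx : Transcendental k x)
    (hF : IntermediateField.adjoin k {x, z} = ⊤) (hz : z ^ m = aeval x h) :
    (∀ f : F, ∃ (q : k[X]) (p : Fin m → k[X]), q ≠ 0 ∧
      aeval x q * f = ∑ i, aeval x (p i) * z ^ (i : ℕ)) ∧
    ∀ f : F, (∀ Q : Place k F, 0 ≤ Q.v x → 0 ≤ Q.v f) →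
      ∃ (N : ℕ) (p : Fin m → k[X]),
        aeval x (h ^ N) * f = ∑ i, aeval x (p i) * z ^ (i : ℕ) := by
  have hm0 : m ≠ 0 := by
    rintro rfl
    simp at hm
  have hh0 : h ≠ 0 := by
    rw [hh]
    refine mul_ne_zero (X_sub_C_ne_zero a) ?_
    rintro rfl
    simp at hg
  let : Algebra k[X] F := (aeval x).toAlgebra
  have hX : algebraMap k[X] F X = x := aeval_X x
  have : IsScalarTower k k[X] F := IsScalarTower.of_algebraMap_eq fun c => (aeval_C x c).symm
  have : FaithfulSMul k[X] F := (faithfulSMul_iff_algebraMap_injective _ _).2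
    (transcendental_iff_injective.1 hx)
  let : Algebra (FractionRing k[X]) F := FractionRing.liftAlgebra k[X] F
  have hz' : z ^ m = algebraMap k[X] F h := hz
  have htop : IntermediateField.adjoin (FractionRing k[X]) {z} = ⊤ := by
    refine adjoin_eq_top_of_subset (FractionRing k[X]) hF (fun c => ?_) ?_
    · rw [IsScalarTower.algebraMap_apply k k[X] F,
        IsScalarTower.algebraMap_apply k[X] (FractionRing k[X]) F]
      exact IntermediateField.algebraMap_mem _ _
    · rintro f (rfl | rfl)
      · rw [← hX, IsScalarTower.algebraMap_apply k[X] (FractionRing k[X]) F]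
        exact IntermediateField.algebraMap_mem _ _
      · exact IntermediateField.mem_adjoin_simple_self _ _
  have hfin := finiteDimensional_of_pow_eq (FractionRing k[X]) hm0 hz' htop
  have hsep := isSeparable_of_pow_eq (FractionRing k[X]) hm hh hg hz' htop
  have hint : ∀ f : F, IsIntegral k[X] f → ∃ (N : ℕ) (p : Fin m → k[X]),
        aeval x (h ^ N) * f = ∑ i, aeval x (p i) * z ^ (i : ℕ) := fun f hf =>
    exists_pow_mul_eq_sum (FractionRing k[X]) hm hh hg hz' htop hf
  refine ⟨fun f => ?_, fun f hf => ?_⟩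
  · have hf : IsAlgebraic k[X] f := (IsFractionRing.isAlgebraic_iff k[X] (FractionRing k[X]) F).2
      (Algebra.IsAlgebraic.isAlgebraic f)
    obtain ⟨q, hq, hqf⟩ := hf.exists_integral_multiple
    obtain ⟨N, p, hp⟩ := hint _ hqf
    refine ⟨h ^ N * q, p, mul_ne_zero (pow_ne_zero N hh0) hq, ?_⟩
    rw [← hp, Algebra.smul_def, map_mul, mul_assoc]
    rfl
  · exact hint f (isIntegral_of_forall_place (FractionRing k[X]) (by rwa [hX]))

end Kummer

/-! ### The polynomial with roots `α μ`, and counting roots. -/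

section RationalPoints

/-- The polynomial `∏ (X - α μ)`. -/
noncomputable def rootPolynomial {k : Type*} [Field k] {ι : Type*} [Fintype ι] (α : ι → k) : k[X] :=
  ∏ μ, (X - C (α μ))

variable {k : Type*} [Field k] {ι : Type*} [Fintype ι] {α : ι → k}

theorem rootPolynomial_monic : (rootPolynomial α).Monic :=
  monic_prod_X_sub_C _ _

theorem natDegree_rootPolynomial : (rootPolynomial α).natDegree = Fintype.card ι :=
  natDegree_finsetProd_X_sub_C_eq_card _ _

theorem exists_rootPolynomial_eq_mul (hα : Function.Injective α) (μ : ι) :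
    ∃ g : k[X], rootPolynomial α = (X - C (α μ)) * g ∧ g.eval (α μ) ≠ 0 := by
  classical
  refine ⟨∏ ν ∈ Finset.univ.erase μ, (X - C (α ν)),
    (Finset.mul_prod_erase _ _ (Finset.mem_univ μ)).symm, ?_⟩
  rw [eval_prod, Finset.prod_ne_zero_iff]
  intro ν hν
  rw [eval_sub, eval_X, eval_C, sub_ne_zero]
  exact (hα.ne (Finset.ne_of_mem_erase hν)).symm

theorem le_rootMultiplicity_pow (hα : Function.Injective α) (N : ℕ) (μ : ι) :
    N ≤ (rootPolynomial α ^ N).rootMultiplicity (α μ) := by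
  obtain ⟨g, hg, -⟩ := exists_rootPolynomial_eq_mul hα μ
  rw [le_rootMultiplicity_iff (pow_ne_zero _ rootPolynomial_monic.ne_zero)]
  exact pow_dvd_pow_of_dvd ⟨g, hg⟩ N

theorem sum_rootMultiplicity_le_natDegree (hα : Function.Injective α) (p : k[X]) :
    ∑ μ, p.rootMultiplicity (α μ) ≤ p.natDegree := by
  classical
  calc ∑ μ, p.rootMultiplicity (α μ) = ∑ a ∈ Finset.univ.image α, p.roots.count a := by
        rw [Finset.sum_image fun _ _ _ _ h => hα h]
        simp only [count_roots]
    _ ≤ p.roots.card := by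
        rw [← Multiset.toFinset_sum_count_eq]
        refine Finset.sum_le_sum_of_ne_zero fun a _ ha => ?_
        exact Multiset.mem_toFinset.2 (Multiset.count_ne_zero.1 ha)
    _ ≤ p.natDegree := p.card_roots'

end RationalPoints

/-! ### Orders at the places of the normalized Kummer extension. -/

section Kummer

/-- `F = k(x, z)` is the Kummer extension `z ^ m = ∏ (x - α μ)` of the rational function field
`k(x)`, of degree `m` prime to the characteristic and to the number of the `α μ`. -/
structure IsKummer {k F : Type*} [Field k] [Field F] [Algebra k F] (m : ℕ) {n : ℕ}
    (α : Fin (n + 1) → k) (x z : F) : Prop where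
  natCast_ne_zero : (m : k) ≠ 0
  coprime : IsCoprime (m : ℤ) ((n + 1 : ℕ) : ℤ)
  injective : Function.Injective α
  transcendental : Transcendental k x
  adjoin_eq_top : IntermediateField.adjoin k {x, z} = ⊤
  pow_eq : z ^ m = aeval x (rootPolynomial α)

namespace IsKummer

variable {k F : Type*} [Field k] [Field F] [Algebra k F] {m n : ℕ} {α : Fin (n + 1) → k} {x z : F}

theorem ne_zero (hK : IsKummer m α x z) : m ≠ 0 := by
  rintro rfl
  simpa using hK.natCast_ne_zero

theorem exists_expansion (hK : IsKummer m α x z) (f : F) : ∃ (q : k[X]) (p : Fin m → k[X]),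
    q ≠ 0 ∧ aeval x q * f = ∑ i, aeval x (p i) * z ^ (i : ℕ) := by
  obtain ⟨g, hg, hg'⟩ := exists_rootPolynomial_eq_mul hK.injective 0
  exact (exists_expansions hK.natCast_ne_zero hg hg' hK.transcendental hK.adjoin_eq_top
    hK.pow_eq).1 f

theorem exists_pow_expansion (hK : IsKummer m α x z) {f : F}
    (hf : ∀ Q : Place k F, 0 ≤ Q.v x → 0 ≤ Q.v f) : ∃ (N : ℕ) (p : Fin m → k[X]),
      aeval x (rootPolynomial α ^ N) * f = ∑ i, aeval x (p i) * z ^ (i : ℕ) := by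
  obtain ⟨g, hg, hg'⟩ := exists_rootPolynomial_eq_mul hK.injective 0
  exact (exists_expansions hK.natCast_ne_zero hg hg' hK.transcendental hK.adjoin_eq_top
    hK.pow_eq).2 f hf

theorem sub_ne_zero (hK : IsKummer m α x z) (a : k) : x - algebraMap k F a ≠ 0 := by
  intro h0
  exact X_sub_C_ne_zero a ((transcendental_iff.1 hK.transcendental) (X - C a) (by simpa using h0))

theorem degree_pos (hK : IsKummer m α x z) (Q : Place k F) : 0 < Q.degree := by
  refine Q.degree_pos_of_adjoin_pair hK.transcendental hK.adjoin_eq_top ?_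
  let b : Algebra.adjoin k {x} := ⟨aeval x (rootPolynomial α), aeval_mem_adjoin_singleton k x⟩
  refine IsIntegral.isAlgebraic ⟨X ^ m - C b, monic_X_pow_sub_C b hK.ne_zero, ?_⟩
  simp only [eval₂_sub, eval₂_X_pow, eval₂_C]
  rw [hK.pow_eq]
  exact sub_self _

theorem orders_at_zero (hK : IsKummer m α x z) {Q : Place k F} {μ : Fin (n + 1)}
    (hQ : 0 < Q.v (x - algebraMap k F (α μ))) :
    Q.v z = ((1 : ℤ) : WithTop ℤ) ∧ ∀ p : k[X], p ≠ 0 →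
      Q.v (aeval x p) = ((m * p.rootMultiplicity (α μ) : ℤ) : WithTop ℤ) := by
  obtain ⟨g, hg, hg'⟩ := exists_rootPolynomial_eq_mul hK.injective μ
  exact Q.orders_at_zero hK.ne_zero hg hg' hK.pow_eq hK.exists_expansion hQ hK.transcendental

theorem orders_at_infinity (hK : IsKummer m α x z) {Q : Place k F} (hQ : Q.v x < 0) :
    Q.v z = ((-(n + 1 : ℕ) : ℤ) : WithTop ℤ) ∧ ∀ p : k[X], p ≠ 0 →
      Q.v (aeval x p) = ((m * -p.natDegree : ℤ) : WithTop ℤ) := by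
  have hd : (rootPolynomial α).natDegree = n + 1 := by
    rw [natDegree_rootPolynomial, Fintype.card_fin]
  have := Q.orders_at_infinity hK.ne_zero rootPolynomial_monic.ne_zero
    (by rw [hd]; exact hK.coprime) hK.pow_eq hK.exists_expansion hQ
  rwa [hd] at this

theorem eq_of_zero (hK : IsKummer m α x z) {Q Q' : Place k F} {μ : Fin (n + 1)}
    (hQ : 0 < Q.v (x - algebraMap k F (α μ))) (hQ' : 0 < Q'.v (x - algebraMap k F (α μ))) :
    Q = Q' :=
  Place.eq_of_orders_eq (ord := fun p => p.rootMultiplicity (α μ)) isCoprime_one_right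
    (hK.orders_at_zero hQ).1 (hK.orders_at_zero hQ').1 (hK.orders_at_zero hQ).2
    (hK.orders_at_zero hQ').2 hK.exists_expansion

theorem eq_of_infinity (hK : IsKummer m α x z) {Q Q' : Place k F} (hQ : Q.v x < 0)
    (hQ' : Q'.v x < 0) : Q = Q' :=
  Place.eq_of_orders_eq (ord := fun p => -p.natDegree) hK.coprime.neg_right
    (hK.orders_at_infinity hQ).1 (hK.orders_at_infinity hQ').1 (hK.orders_at_infinity hQ).2
    (hK.orders_at_infinity hQ').2 hK.exists_expansion

theorem v_sub_of_infinity (hK : IsKummer m α x z) {Q : Place k F} (hQ : Q.v x < 0) (a : k) :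
    Q.v (x - algebraMap k F a) = ((-m : ℤ) : WithTop ℤ) := by
  have := (hK.orders_at_infinity hQ).2 (X - C a) (X_sub_C_ne_zero a)
  rw [natDegree_X_sub_C] at this
  simpa using this

theorem v_sub_of_zero (hK : IsKummer m α x z) {Q : Place k F} {μ : Fin (n + 1)}
    (hQ : 0 < Q.v (x - algebraMap k F (α μ))) (ν : Fin (n + 1)) :
    Q.v (x - algebraMap k F (α ν)) = ((if ν = μ then (m : ℤ) else 0 : ℤ) : WithTop ℤ) := by
  classical
  have := (hK.orders_at_zero hQ).2 (X - C (α ν)) (X_sub_C_ne_zero _)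
  rw [rootMultiplicity_X_sub_C] at this
  simp only [map_sub, aeval_X, aeval_C, hK.injective.eq_iff, eq_comm (a := μ)] at this
  rw [this]
  split_ifs <;> simp

theorem v_eq_zero_of_other (hK : IsKummer m α x z) {Q : Place k F} (hQ : 0 ≤ Q.v x)
    (hQ' : ∀ μ, ¬ 0 < Q.v (x - algebraMap k F (α μ))) :
    (∀ μ, Q.v (x - algebraMap k F (α μ)) = 0) ∧ Q.v z = 0 := by
  have h1 : ∀ μ, Q.v (x - algebraMap k F (α μ)) = 0 := fun μ =>
    le_antisymm (not_lt.1 (hQ' μ)) (AddValuation.map_le_sub Q.v hQ (Q.const_nonneg _))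
  refine ⟨h1, ?_⟩
  have h2 : m • Q.v z = 0 := by
    rw [← AddValuation.map_pow, hK.pow_eq, rootPolynomial, map_prod]
    have : ∀ S : Finset (Fin (n + 1)), Q.v (∏ μ ∈ S, aeval x (X - C (α μ))) = 0 := fun S => by
      classical
      induction S using Finset.induction_on with
      | empty => simp
      | insert μ S hμ ih =>
        rw [Finset.prod_insert hμ, AddValuation.map_mul, ih, add_zero]
        simpa using h1 μ
    exact this _
  have hz0 : z ≠ 0 := by
    rintro rfl
    obtain ⟨m', hm'⟩ := Nat.exists_eq_succ_of_ne_zero hK.ne_zero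
    rw [hm'] at h2
    simp [succ_nsmul] at h2
  obtain ⟨d, hd⟩ := Q.exists_int hz0
  rw [hd, ← WithTop.coe_nsmul, nsmul_eq_mul] at h2
  have h3 : (m : ℤ) * d = 0 := by exact_mod_cast h2
  rw [hd, (mul_eq_zero.1 h3).resolve_left (by exact_mod_cast hK.ne_zero)]
  rfl

end IsKummer

end Kummer

/-! ### Functions attached to lattice points. -/

section LatticeFunction

variable {k F : Type*} [Field k] [Field F] [Algebra k F] {m n : ℕ} {α : Fin (n + 1) → k} {x z : F}

/-- The function `z ^ i * ∏ (x - α_a) ^ j_a` attached to a lattice point. -/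
noncomputable def latticeFunction {n : ℕ} (α : Fin (n + 1) → k) (x z : F)
    (w : ℤ × (Fin n → ℤ)) : F :=
  z ^ w.1 * ∏ a : Fin n, (x - algebraMap k F (α a.succ)) ^ w.2 a

theorem Place.v_latticeFunction (Q : Place k F) {c : ℤ} {b : Fin n → ℤ} (hz : Q.v z = c)
    (hx : ∀ a : Fin n, Q.v (x - algebraMap k F (α a.succ)) = b a) (w : ℤ × (Fin n → ℤ)) :
    Q.v (latticeFunction α x z w) = ((w.1 * c + ∑ a, w.2 a * b a : ℤ) : WithTop ℤ) := by
  have : ∀ S : Finset (Fin n), Q.v (∏ a ∈ S, (x - algebraMap k F (α a.succ)) ^ w.2 a) =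
      ((∑ a ∈ S, w.2 a * b a : ℤ) : WithTop ℤ) := fun S => by
    classical
    induction S using Finset.induction_on with
    | empty => simp
    | insert a S ha ih =>
      rw [Finset.prod_insert ha, Finset.sum_insert ha, AddValuation.map_mul, ih,
        Q.zpow_eq (hx a), ← WithTop.coe_add]
  rw [latticeFunction, AddValuation.map_mul, this, Q.zpow_eq hz, ← WithTop.coe_add]

namespace IsKummer

theorem latticeFunction_at_zero (hK : IsKummer m α x z) {Q : Place k F} {μ : Fin (n + 1)}
    (hQ : 0 < Q.v (x - algebraMap k F (α μ))) (w : ℤ × (Fin n → ℤ)) :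
    Q.v (latticeFunction α x z w) = (latticeOrder m w μ : WithTop ℤ) := by
  rw [Q.v_latticeFunction (hK.orders_at_zero hQ).1 (fun a => hK.v_sub_of_zero hQ a.succ)]
  congr 1
  refine Fin.cases ?_ (fun b => ?_) μ
  · simp [latticeOrder]
  · simp [latticeOrder, mul_comm]

theorem latticeFunction_at_infinity (hK : IsKummer m α x z) {Q : Place k F} (hQ : Q.v x < 0)
    (w : ℤ × (Fin n → ℤ)) :
    Q.v (latticeFunction α x z w) = ((-latticePole m w : ℤ) : WithTop ℤ) := by
  rw [Q.v_latticeFunction (hK.orders_at_infinity hQ).1 (fun a => hK.v_sub_of_infinity hQ _)]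
  congr 1
  rw [latticePole, ← Finset.sum_mul]
  ring

theorem latticeFunction_of_other (hK : IsKummer m α x z) {Q : Place k F} (hQ : 0 ≤ Q.v x)
    (hQ' : ∀ μ, ¬ 0 < Q.v (x - algebraMap k F (α μ))) (w : ℤ × (Fin n → ℤ)) :
    Q.v (latticeFunction α x z w) = 0 := by
  obtain ⟨h1, h2⟩ := hK.v_eq_zero_of_other hQ hQ'
  rw [Q.v_latticeFunction (c := 0) (b := fun _ => 0) h2 (fun a => h1 a.succ)]
  simp

end IsKummer

end LatticeFunction

/-! ### Comparing `L(H)` with `Ω`. -/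

section RiemannRoch

variable {k F : Type*} [Field k] [Field F] [Algebra k F] {m n : ℕ} {α : Fin (n + 1) → k} {x z : F}
  {P : Fin (n + 1) → Place k F} {Pinf : Place k F} {s : Fin (n + 1) → ℤ} {t : ℤ}

namespace IsKummer

theorem injective_places (hK : IsKummer m α x z)
    (hP : ∀ μ, 0 < (P μ).v (x - algebraMap k F (α μ))) : Function.Injective P := by
  intro μ ν h
  by_contra hne
  have h1 := hK.v_sub_of_zero (hP μ) ν
  rw [if_neg (Ne.symm hne), h] at h1
  exact (hP ν).ne' h1

theorem places_ne_infinity (hP : ∀ μ, 0 < (P μ).v (x - algebraMap k F (α μ)))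
    (hPinf : Pinf.v x < 0) (μ : Fin (n + 1)) : P μ ≠ Pinf := by
  rintro rfl
  exact hPinf.not_ge ((P μ).nonneg_of_sub_const (hP μ).le)

theorem latticeFunction_mem (hK : IsKummer m α x z)
    (hP : ∀ μ, 0 < (P μ).v (x - algebraMap k F (α μ))) (hPinf : Pinf.v x < 0)
    {w : ℤ × (Fin n → ℤ)} (hw : w ∈ latticeOmega m s t) :
    latticeFunction α x z w ∈ riemannRochSpace (kummerDivisor P Pinf s t) := by
  refine (mem_riemannRochSpace_kummerDivisor s t (hK.injective_places hP)
    (places_ne_infinity hP hPinf)).2 ⟨fun μ => ?_, ?_, fun Q hQ hQ' => ?_⟩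
  · rw [hK.latticeFunction_at_zero (hP μ), WithTop.coe_le_coe]
    exact neg_le_latticeOrder hw μ
  · rw [hK.latticeFunction_at_infinity hPinf, WithTop.coe_le_coe]
    exact neg_le_neg hw.2.2
  · rw [hK.latticeFunction_of_other]
    · exact not_lt.1 fun h => hQ' (hK.eq_of_infinity h hPinf)
    · exact fun μ h => hQ μ (hK.eq_of_zero h (hP μ))

/-- Poles of `f` away from infinity lie only over the `α μ`, so a power of `h` makes `f` integral
over `k[x]`; the discriminant argument then costs a further power of `h`. -/
theorem exists_pow_expansion_of_mem (hK : IsKummer m α x z)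
    (hP : ∀ μ, 0 < (P μ).v (x - algebraMap k F (α μ))) (hPinf : Pinf.v x < 0) {f : F}
    (hf : f ∈ riemannRochSpace (kummerDivisor P Pinf s t)) (hf0 : f ≠ 0) :
    ∃ (M : ℕ) (p : Fin m → k[X]),
      aeval x (rootPolynomial α ^ M) * f = ∑ i, aeval x (p i) * z ^ (i : ℕ) := by
  obtain ⟨h1, -, h3⟩ := (mem_riemannRochSpace_kummerDivisor s t (hK.injective_places hP)
    (places_ne_infinity hP hPinf)).1 hf
  -- This `N` bounds every `s μ`, so `h ^ N`, of order at least `m * N` at each `P μ`, cancels the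
  -- poles there.
  set N : ℕ := ∑ μ, (s μ).toNat with hN
  obtain ⟨N', p, hp⟩ := hK.exists_pow_expansion (f := aeval x (rootPolynomial α ^ N) * f)
    fun Q hQ => by
      rw [AddValuation.map_mul]
      by_cases hQP : ∃ μ, Q = P μ
      · obtain ⟨μ, rfl⟩ := hQP
        obtain ⟨b, hb⟩ := (P μ).exists_int hf0
        have hsb := h1 μ
        rw [hb, WithTop.coe_le_coe] at hsb
        rw [(hK.orders_at_zero (hP μ)).2 _ (pow_ne_zero _ rootPolynomial_monic.ne_zero), hb,
          ← WithTop.coe_add, ← WithTop.coe_zero, WithTop.coe_le_coe]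
        have h4 : (N : ℤ) ≤ (rootPolynomial α ^ N).rootMultiplicity (α μ) := by
          exact_mod_cast le_rootMultiplicity_pow hK.injective N μ
        have h5 : s μ ≤ N := by
          have : (s μ).toNat ≤ N := by
            rw [hN]
            exact Finset.single_le_sum (f := fun μ => (s μ).toNat) (fun _ _ => Nat.zero_le _)
              (Finset.mem_univ μ)
          exact (Int.self_le_toNat _).trans (by exact_mod_cast this)
        have h6 : (1 : ℤ) ≤ m := by exact_mod_cast Nat.one_le_iff_ne_zero.2 hK.ne_zero
        nlinarith
      · push Not at hQP
        refine add_nonneg (Q.aeval_nonneg hQ _) (h3 Q hQP ?_)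
        rintro rfl
        exact hPinf.not_ge hQ
  exact ⟨N' + N, p, by rw [← hp, pow_add, map_mul, mul_assoc]⟩

/-- The orders of a function in `L(H)` are bounded below by the orders of the lattice points. -/
theorem exists_lattice_le (hK : IsKummer m α x z)
    (hP : ∀ μ, 0 < (P μ).v (x - algebraMap k F (α μ))) (hPinf : Pinf.v x < 0) {f : F}
    (hf : f ∈ riemannRochSpace (kummerDivisor P Pinf s t)) (hf0 : f ≠ 0) :
    (∀ μ, ∃ w ∈ latticeOmega m s t, (latticeOrder m w μ : WithTop ℤ) ≤ (P μ).v f) ∧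
      ∃ w ∈ latticeOmega m s t, ((-latticePole m w : ℤ) : WithTop ℤ) ≤ Pinf.v f := by
  obtain ⟨M, p, hp⟩ := hK.exists_pow_expansion_of_mem hP hPinf hf hf0
  obtain ⟨h1, h2, -⟩ := (mem_riemannRochSpace_kummerDivisor s t (hK.injective_places hP)
    (places_ne_infinity hP hPinf)).1 hf
  have hM0 : rootPolynomial α ^ M ≠ 0 := pow_ne_zero _ rootPolynomial_monic.ne_zero
  set R : Fin (n + 1) → ℤ := fun μ => (rootPolynomial α ^ M).rootMultiplicity (α μ) with hR
  set D : ℤ := ((rootPolynomial α ^ M).natDegree : ℤ) with hD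
  -- All roots of the denominator are among the `α μ`. For a general denominator this inequality,
  -- and with it `∑ V ≤ T`, could fail.
  have hDR : D ≤ ∑ μ, R μ := by
    have h4 : ∑ _μ : Fin (n + 1), (M : ℤ) ≤ ∑ μ, R μ := Finset.sum_le_sum fun μ _ => by
      simp only [hR]
      exact_mod_cast le_rootMultiplicity_pow hK.injective M μ
    refine le_trans (le_of_eq ?_) h4
    rw [hD, natDegree_pow, natDegree_rootPolynomial]
    simp
    ring
  -- `V i μ` and, below, `T i` are the order at `P μ` and the pole order at infinity of the single
  -- term `p_i(x) z ^ i / h(x) ^ M`, if `p i ≠ 0`.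
  set V : Fin m → Fin (n + 1) → ℤ := fun i μ =>
    m * (p i).rootMultiplicity (α μ) + (i : ℕ) - m * R μ with hV
  set T : Fin m → ℤ := fun i =>
    m * (p i).natDegree + ((n + 1 : ℕ) : ℤ) * (i : ℕ) - m * D with hT
  have hterm : ∀ μ i, p i ≠ 0 → (P μ).v (aeval x (p i) * z ^ (i : ℕ)) =
      ((m * (p i).rootMultiplicity (α μ) + (i : ℕ) : ℤ) : WithTop ℤ) := fun μ i hi => by
    have := (P μ).map_aeval_mul_pow (e := 1) (c := 1)
      (ord := fun p => p.rootMultiplicity (α μ)) (by simpa using (hK.orders_at_zero (hP μ)).1)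
      (by simpa only [one_mul] using (hK.orders_at_zero (hP μ)).2) hi i
    simpa only [one_mul, mul_one] using this
  have htermInf : ∀ i, p i ≠ 0 → Pinf.v (aeval x (p i) * z ^ (i : ℕ)) =
      ((m * -(p i).natDegree + (i : ℕ) * -(n + 1 : ℕ) : ℤ) : WithTop ℤ) := fun i hi => by
    have := Pinf.map_aeval_mul_pow (e := 1) (c := -(n + 1 : ℕ))
      (ord := fun p => -p.natDegree) (by simpa only [one_mul] using (hK.orders_at_infinity hPinf).1)
      (by simpa only [one_mul] using (hK.orders_at_infinity hPinf).2) hi i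
    simpa only [one_mul] using this
  have hinf : ∀ μ, ((m * R μ : ℤ) : WithTop ℤ) + (P μ).v f =
      Finset.univ.inf fun i : Fin m => (P μ).v (aeval x (p i) * z ^ (i : ℕ)) := fun μ => by
    rw [← (P μ).map_sum_aeval_mul_pow (e := 1) (c := 1)
      (ord := fun p => p.rootMultiplicity (α μ)) isCoprime_one_right one_ne_zero
      (by simpa using (hK.orders_at_zero (hP μ)).1)
      (by simpa only [one_mul] using (hK.orders_at_zero (hP μ)).2) p, ← hp, AddValuation.map_mul,
      (hK.orders_at_zero (hP μ)).2 _ hM0]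
  have hinfInf : ((m * -D : ℤ) : WithTop ℤ) + Pinf.v f =
      Finset.univ.inf fun i : Fin m => Pinf.v (aeval x (p i) * z ^ (i : ℕ)) := by
    rw [← Pinf.map_sum_aeval_mul_pow (e := 1) (c := -(n + 1 : ℕ))
      (ord := fun p => -p.natDegree) hK.coprime.neg_right one_ne_zero
      (by simpa only [one_mul] using (hK.orders_at_infinity hPinf).1)
      (by simpa only [one_mul] using (hK.orders_at_infinity hPinf).2) p, ← hp,
      AddValuation.map_mul, (hK.orders_at_infinity hPinf).2 _ hM0]
  have hpoints : ∀ i, p i ≠ 0 → (∃ w ∈ latticeOmega m s t, ∀ μ, latticeOrder m w μ ≤ V i μ) ∧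
      ∃ w ∈ latticeOmega m s t, latticePole m w = T i := fun i hi => by
    refine exists_lattice_points hK.ne_zero (fun μ => ?_) ?_ ?_ (fun μ => ?_) ?_
    -- The order of `f` is the minimum over the terms, so each term inherits the bound that `H`
    -- imposes on `f`.
    · obtain ⟨b, hb⟩ := (P μ).exists_int hf0
      have h4 := (hinf μ).le.trans (Finset.inf_le (Finset.mem_univ i))
      have h5 := h1 μ
      rw [hterm μ i hi, hb, ← WithTop.coe_add, WithTop.coe_le_coe] at h4
      rw [hb, WithTop.coe_le_coe] at h5
      simp only [hV]
      linarith
    · obtain ⟨b, hb⟩ := Pinf.exists_int hf0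
      have h4 := hinfInf.le.trans (Finset.inf_le (Finset.mem_univ i))
      have h5 := h2
      rw [htermInf i hi, hb, ← WithTop.coe_add, WithTop.coe_le_coe] at h4
      rw [hb, WithTop.coe_le_coe] at h5
      simp only [hT]
      linarith
    · have h4 : (∑ μ, ((p i).rootMultiplicity (α μ) : ℤ)) ≤ (p i).natDegree := by
        exact_mod_cast sum_rootMultiplicity_le_natDegree hK.injective (p i)
      have h5 : (0 : ℤ) ≤ m := Int.natCast_nonneg m
      have h6 := mul_le_mul_of_nonneg_left h4 h5
      have h7 := mul_le_mul_of_nonneg_left hDR h5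
      simp only [hV, hT, Finset.sum_sub_distrib, Finset.sum_add_distrib, ← Finset.mul_sum,
        Finset.sum_const, Finset.card_univ, Fintype.card_fin, nsmul_eq_mul]
      linarith
    · refine Int.modEq_iff_dvd.2 ⟨(p i).rootMultiplicity (α 0) - R 0 -
        ((p i).rootMultiplicity (α μ) - R μ), ?_⟩
      simp only [hV]
      ring
    · refine Int.modEq_iff_dvd.2 ⟨((n + 1 : ℕ) : ℤ) * ((p i).rootMultiplicity (α 0) - R 0) -
        ((p i).natDegree - D), ?_⟩
      simp only [hV, hT]
      ring
  have hne : (Finset.univ : Finset (Fin m)).Nonempty :=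
    ⟨⟨0, Nat.pos_of_ne_zero hK.ne_zero⟩, Finset.mem_univ _⟩
  -- At each place, choose the term that attains the minimum, so that its order is that of `f`; the
  -- choice may differ from place to place.
  refine ⟨fun μ => ?_, ?_⟩
  · obtain ⟨i, -, hi⟩ := Finset.exists_mem_eq_inf _ hne
      fun i : Fin m => (P μ).v (aeval x (p i) * z ^ (i : ℕ))
    obtain ⟨b, hb⟩ := (P μ).exists_int hf0
    have h4 := (hinf μ).trans hi
    rw [hb, ← WithTop.coe_add] at h4
    have hpi : p i ≠ 0 := by
      intro h0
      rw [h0, map_zero, zero_mul, AddValuation.map_zero] at h4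
      exact WithTop.coe_ne_top h4
    rw [hterm μ i hpi, WithTop.coe_inj] at h4
    obtain ⟨w, hw, hwV⟩ := (hpoints i hpi).1
    refine ⟨w, hw, ?_⟩
    rw [hb, WithTop.coe_le_coe]
    refine (hwV μ).trans ?_
    simp only [hV]
    linarith
  · obtain ⟨i, -, hi⟩ := Finset.exists_mem_eq_inf _ hne
      fun i : Fin m => Pinf.v (aeval x (p i) * z ^ (i : ℕ))
    obtain ⟨b, hb⟩ := Pinf.exists_int hf0
    have h4 := hinfInf.trans hi
    rw [hb, ← WithTop.coe_add] at h4
    have hpi : p i ≠ 0 := by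
      intro h0
      rw [h0, map_zero, zero_mul, AddValuation.map_zero] at h4
      exact WithTop.coe_ne_top h4
    rw [htermInf i hpi, WithTop.coe_inj] at h4
    obtain ⟨w, hw, hwT⟩ := (hpoints i hpi).2
    refine ⟨w, hw, ?_⟩
    rw [hb, WithTop.coe_le_coe, hwT]
    simp only [hT]
    linarith

end IsKummer

end RiemannRoch

end FunField

open FunField

/-! ### The floor from the maxima over `Ω`. -/

theorem theorem5p4 {k F : Type*} [Field k] [Finite k] [Field F] [Algebra k F]
    (p : ℕ) [CharP k p] (m : ℕ) (hm : 2 ≤ m) (hpm : Nat.gcd p m = 1)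
    (n : ℕ) (l : ℤ) (hgcd : Int.gcd (m : ℤ) (((n + 1 : ℕ) : ℤ) * l) = 1)
    (α : Fin (n + 1) → k) (hα : Function.Injective α)
    -- `F = k(x, y)` is the Kummer extension of the rational function field `k(x)`
    (x y : F) (hx : Transcendental k x) (hF : IntermediateField.adjoin k {x, y} = ⊤)
    (hxy : y ^ m = ∏ μ, (x - algebraMap k F (α μ)) ^ l)
    -- the places over the zeros of the `x - α μ` and over the pole of `x`
    (P : Fin (n + 1) → FunField.Place k F)
    (hP : ∀ μ, 0 < (P μ).v (x - algebraMap k F (α μ)))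
    (Pinf : FunField.Place k F) (hPinf : Pinf.v x < 0)
    (s : Fin (n + 1) → ℤ) (t : ℤ)
    (hell : 0 < FunField.ell (FunField.kummerDivisor P Pinf s t)) :
    ∃ (s' : Fin (n + 1) → ℤ) (t' : ℤ),
      IsGreatest {c : ℤ | ∃ w ∈ FunField.latticeOmega m s t, c = -w.1} (s' 0) ∧
      (∀ a : Fin n, IsGreatest
        {c : ℤ | ∃ w ∈ FunField.latticeOmega m s t, c = -w.1 - m * w.2 a} (s' a.succ)) ∧
      IsGreatest {c : ℤ | ∃ w ∈ FunField.latticeOmega m s t,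
        c = ((n + 1 : ℕ) : ℤ) * w.1 + m * ∑ a, w.2 a} t' ∧
      FunField.IsFloor (FunField.kummerDivisor P Pinf s t)
        (FunField.kummerDivisor P Pinf s' t') := by
  have hm0 : m ≠ 0 := by omega
  have hmk : (m : k) ≠ 0 := by
    intro h
    have h1 : p ∣ m := (CharP.cast_eq_zero_iff k p m).1 h
    rw [Nat.gcd_eq_left h1] at hpm
    exact CharP.char_ne_one k p hpm
  have hcop := Int.isCoprime_iff_gcd_eq_one.2 hgcd
  have hH : aeval x (rootPolynomial α) = ∏ μ, (x - algebraMap k F (α μ)) := by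
    simp [rootPolynomial, map_prod]
  have hH0 : aeval x (rootPolynomial α) ≠ 0 := fun h =>
    rootPolynomial_monic.ne_zero (transcendental_iff.1 hx _ h)
  obtain ⟨z, hz, hyz⟩ := exists_pow_eq_of_pow_eq_zpow
    (IsCoprime.of_mul_right_right hcop) hm0 hH0 (y := y) (by rw [hxy, hH, Finset.prod_zpow])
  have htop : IntermediateField.adjoin k {x, z} = ⊤ := by
    refine adjoin_eq_top_of_subset k hF (IntermediateField.algebraMap_mem _) ?_
    rintro f (rfl | rfl)
    · exact IntermediateField.subset_adjoin k _ (by simp)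
    · rw [hyz]
      exact zpow_mem (IntermediateField.subset_adjoin k _ (by simp)) l
  have hK : IsKummer m α x z :=
    ⟨hmk, IsCoprime.of_mul_right_left hcop, hα, hx, htop, hz⟩
  have hL : riemannRochSpace (kummerDivisor P Pinf s t) ≠ ⊥ := by
    intro h
    rw [ell, h, finrank_bot] at hell
    exact hell.false
  -- A nonzero function makes `Ω` nonempty, so the maxima exist. The function of the point `w₀` also
  -- serves below as the element of value `0` at every other place.
  obtain ⟨f₀, hf₀, hf₀'⟩ := Submodule.exists_mem_ne_zero_of_ne_bot hL
  obtain ⟨w₀, hw₀, -⟩ := (hK.exists_lattice_le hP hPinf hf₀ hf₀').2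
  have hmax : ∀ μ, ∃ c, IsGreatest {c : ℤ | ∃ w ∈ latticeOmega m s t, c = -latticeOrder m w μ} c :=
    fun μ => exists_isGreatest_of_subset_Iic (b := s μ) ⟨_, w₀, hw₀, rfl⟩ (by
      rintro c ⟨w, hw, rfl⟩
      linarith [neg_le_latticeOrder hw μ])
  have hmaxInf : ∃ c, IsGreatest {c : ℤ | ∃ w ∈ latticeOmega m s t, c = latticePole m w} c :=
    exists_isGreatest_of_subset_Iic (b := t) ⟨_, w₀, hw₀, rfl⟩ (by
      rintro c ⟨w, hw, rfl⟩
      exact hw.2.2)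
  choose s' hs' using hmax
  obtain ⟨t', ht'⟩ := hmaxInf
  refine ⟨s', t', hs' 0, fun a => ?_, ht', ?_⟩
  · have := hs' a.succ
    simp only [latticeOrder, Fin.cons_succ, neg_add'] at this
    exact this
  refine isFloor_kummerDivisor hK.degree_pos (hK.injective_places hP)
    (IsKummer.places_ne_infinity hP hPinf) (fun μ => ?_) ?_ (fun f hf hf0 => ⟨fun μ => ?_, ?_⟩)
    (fun μ => ?_) ?_ (fun Q hQ hQ' => ?_)
  · obtain ⟨w, hw, hw'⟩ := (hs' μ).1
    linarith [neg_le_latticeOrder hw μ]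
  · obtain ⟨w, hw, rfl⟩ := ht'.1
    exact hw.2.2
  · obtain ⟨w, hw, hwf⟩ := (hK.exists_lattice_le hP hPinf hf hf0).1 μ
    exact le_trans (WithTop.coe_le_coe.2 (neg_le.1 ((hs' μ).2 ⟨w, hw, rfl⟩))) hwf
  · obtain ⟨w, hw, hwf⟩ := (hK.exists_lattice_le hP hPinf hf hf0).2
    exact le_trans (WithTop.coe_le_coe.2 (neg_le_neg (ht'.2 ⟨w, hw, rfl⟩))) hwf
  · obtain ⟨w, hw, hw'⟩ := (hs' μ).1
    refine ⟨_, hK.latticeFunction_mem hP hPinf hw, ?_⟩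
    rw [hK.latticeFunction_at_zero (hP μ), hw', neg_neg]
  · obtain ⟨w, hw, hw'⟩ := ht'.1
    refine ⟨_, hK.latticeFunction_mem hP hPinf hw, ?_⟩
    rw [hK.latticeFunction_at_infinity hPinf, hw']
  · refine ⟨_, hK.latticeFunction_mem hP hPinf hw₀, hK.latticeFunction_of_other ?_ ?_ w₀⟩
    · exact not_lt.1 fun h => hQ' (hK.eq_of_infinity h hPinf)
    · exact fun μ h => hQ μ (hK.eq_of_zero h (hP μ))
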